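/- For a group $G$, let $c(G)$ be the Matveev–Pervova complexity of $G$, that is, the minimal length $\sum_{i=1}^m |r_i|$ of a finite presentation $\langle a_1,\dots,a_n \mid r_1,\dots,r_m\rangle$ of $G$, where $|\cdot|$ is the word length in the free group on $a_1,\dots,a_n$. Let $h(G)$ be the minimal number $m$ of relators of a finite presentation of $G$. Let $\kappa(G)$ be the simplicial complexity of $G$, that is, the minimal number of $2$-simplices of a finite connected simplicial complex of dimension at most $2$ with fundamental group isomorphic to $G$. (A minimum over an empty family is $+\infty$; this concerns only groups that are not finitely presentable.) For every group $G$, $$\frac{\kappa(G)+h(G)}{6}\;\le\; c(G),$$ and, if $G$ is not a free group (the trivial group counts as free), then $$c(G)\;\le\; 3\,(\kappa(G)-4).$$ -/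

import Mathlib

open scoped ENNReal

/-- A finite abstract simplicial complex of dimension at most `2`. -/
structure FiniteTwoComplex where
  /-- the vertices -/
  V : Type
  /-- there are finitely many vertices -/
  [fintypeV : Fintype V]
  /-- the simplices, given by their sets of vertices; every vertex is a `0`-simplex -/
  K : AbstractSimplicialComplex V
  /-- every simplex has dimension at most `2` -/
  card_le_three : ∀ s ∈ K.faces, s.card ≤ 3

attribute [instance] FiniteTwoComplex.fintypeV

namespace FiniteTwoComplex

/-- The geometric realization, in barycentric coordinates: the points of the standard simplex on
the vertex set whose coordinates vanish off some simplex of the complex. -/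
def realization (X : FiniteTwoComplex) : Set (X.V → ℝ) :=
  {x | x ∈ stdSimplex ℝ X.V ∧ ∃ s ∈ X.K.faces, ∀ v, v ∉ s → x v = 0}

/-- The number `s₂(X)` of `2`-simplices. -/
noncomputable def numTriangles (X : FiniteTwoComplex) : ℕ :=
  {s : Finset X.V | s ∈ X.K.faces ∧ s.card = 3}.ncard

/-- `X` is connected and its (topological) fundamental group is isomorphic to `G`. -/
def HasFundamentalGroup (X : FiniteTwoComplex) (G : Type*) [Group G] : Prop :=
  PathConnectedSpace X.realization ∧
    ∃ x : X.realization, Nonempty (FundamentalGroup X.realization x ≃* G)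

end FiniteTwoComplex

/-- A finite presentation `⟨a₁, …, aₙ ∣ r₁, …, rₘ⟩` of the group `G`. -/
structure FinPresentation (G : Type*) [Group G] where
  /-- number of generators -/
  n : ℕ
  /-- number of relators -/
  m : ℕ
  /-- the relators -/
  rel : Fin m → FreeGroup (Fin n)
  /-- the group presented is `G` -/
  equiv : PresentedGroup (Set.range rel) ≃* G

/-- The length of a presentation: the sum of the word lengths of its relators. -/
def FinPresentation.length {G : Type*} [Group G] (P : FinPresentation G) : ℕ :=
  ∑ i, (P.rel i).norm

/-- The simplicial complexity `κ(G)`: the infimum of the number of `2`-simplices over all finite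
connected simplicial `2`-complexes with fundamental group `G` (`⊤` if there are none). -/
noncomputable def simplicialComplexity (G : Type*) [Group G] : ℕ∞ :=
  ⨅ (X : FiniteTwoComplex) (_ : X.HasFundamentalGroup G), (X.numTriangles : ℕ∞)

/-- The Matveev–Pervova complexity `c(G)`: the minimal length of a finite presentation of `G`
(`⊤` if there are none). -/
noncomputable def cComplexity (G : Type*) [Group G] : ℕ∞ :=
  ⨅ P : FinPresentation G, (P.length : ℕ∞)

/-- The minimal number `h` of relators of a finite presentation of `G` (`⊤` if there are none). -/
noncomputable def minRelators (G : Type*) [Group G] : ℕ∞ :=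
  ⨅ P : FinPresentation G, (P.m : ℕ∞)

/-! Both bounds compare presentations with complexes through the edge-path group: its generators are
pairs of vertices, with a relation `ab · bc = ac` on each simplex, and with the edges of a rooted
tree and all unjoined pairs trivial. It is the fundamental group of the realization
(`hasFundamentalGroup_iff`). Surjectivity comes from cutting a path into pieces inside open stars.
Injectivity comes from holonomy: a cocycle of edge labels defines a covering space, whose monodromy
reads the labels back off the path.

Upper bound. Let X have the minimal number of triangles, and let r be a vertex. With a tree that
contains all edges at r, the triangles at r only kill further edges, so G has one relator of length
at most 3 for each triangle missing r (`exists_presentation_of_vertex`). If d triangles contain r,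
then c(G) ≤ 3(κ(G) - d), so a vertex with d ≥ 4 suffices. Suppose there is none. As G is not free, X
has a triangle. By minimality no edge lies in exactly one triangle, since it could be collapsed. The
link of a vertex of a triangle then has at most three edges and no ends, so it is a 3-cycle. This
produces the boundary of a tetrahedron, one face of which can be removed without changing the group,
contradicting minimality (`exists_numTriangles_lt`).

Lower bound. Take a presentation of minimal length and drop its trivial relators. Subdivide each
generator circle into three edges, and fill the polygon with 3k sides of a relator of length k by a
collar around an inner cycle of q = ⌊(3k+1)/2⌋ vertices. The outer edges, the inner edges and a fan
inside the cycle contribute 3k, q and q - 2 triangles, at most 6k - 1 together. Summing over the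
relators gives κ(G) + h(G) ≤ 6c(G) (`exists_complex_of_presentation`). That the filling has the
right group is checked by explicit labels in the free group, for which only one closing triangle per
relator fails to multiply to 1. -/

open scoped unitInterval Topology

/-! ### Homotopy classes of paths and open covers -/

/-- Two paths inside a simply connected subset are homotopic in the ambient space. -/
theorem Path.Homotopic.Quotient.mk_eq_mk_of_subset {Y : Type*} [TopologicalSpace Y] (S : Set Y)
    [SimplyConnectedSpace S] {x y : Y} (γ δ : Path x y) (hγ : Set.range γ ⊆ S)
    (hδ : Set.range δ ⊆ S) : Path.Homotopic.Quotient.mk γ = Path.Homotopic.Quotient.mk δ := by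
  have hγ' : ∀ t, γ t ∈ S := fun t => hγ ⟨t, rfl⟩
  have hδ' : ∀ t, δ t ∈ S := fun t => hδ ⟨t, rfl⟩
  have hx : x ∈ S := by simpa using hγ' 0
  have hy : y ∈ S := by simpa using hγ' 1
  let γ' : Path (⟨x, hx⟩ : S) ⟨y, hy⟩ :=
    { toFun := fun t => ⟨γ t, hγ' t⟩
      source' := by simp
      target' := by simp }
  let δ' : Path (⟨x, hx⟩ : S) ⟨y, hy⟩ :=
    { toFun := fun t => ⟨δ t, hδ' t⟩
      source' := by simp
      target' := by simp }
  have h := (SimplyConnectedSpace.paths_homotopic γ' δ').map ⟨Subtype.val, continuous_subtype_val⟩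
  exact Path.Homotopic.Quotient.eq.mpr h

/-- A property of homotopy classes of paths that is stable under concatenation and holds for the
paths inside the members of an open cover holds for all classes. -/
theorem Path.Homotopic.Quotient.induction_of_open_cover {Y ι : Type*} [TopologicalSpace Y]
    (U : ι → Set Y) (hU : ∀ i, IsOpen (U i)) (hcov : ∀ y, ∃ i, y ∈ U i)
    (P : ∀ x y : Y, Path.Homotopic.Quotient x y → Prop)
    (hloc : ∀ (i : ι) (x y : Y) (γ : Path x y), Set.range γ ⊆ U i →
      P x y (Path.Homotopic.Quotient.mk γ))
    (htrans : ∀ (x y z : Y) (p : Path.Homotopic.Quotient x y) (q : Path.Homotopic.Quotient y z),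
      P x y p → P y z q → P x z (p.trans q))
    {x y : Y} (p : Path.Homotopic.Quotient x y) : P x y p := by
  induction p using Path.Homotopic.Quotient.ind with | mk γ => ?_
  -- Lebesgue number: a partition of the unit interval is chosen so that each piece of the path
  -- stays inside one member of the cover.
  obtain ⟨t, ht0, htm, ⟨n, hn⟩, ht⟩ := exists_monotone_Icc_subset_open_cover_unitInterval
    (c := fun i => γ ⁻¹' U i) (fun i => (hU i).preimage γ.continuous)
    (fun s _ => by simpa using hcov (γ s))
  have key : ∀ k, P _ _ (Path.Homotopic.Quotient.mk (γ.subpath (t 0) (t k))) := by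
    intro k
    induction k with
    | zero =>
      obtain ⟨i, hi⟩ := hcov (γ (t 0))
      refine hloc i _ _ _ ?_
      rw [Path.range_subpath_of_le _ _ _ le_rfl]
      simpa using hi
    | succ k ih =>
      obtain ⟨i, hi⟩ := ht k
      have h1 : P _ _ (Path.Homotopic.Quotient.mk (γ.subpath (t k) (t (k + 1)))) := by
        refine hloc i _ _ _ ?_
        rw [Path.range_subpath_of_le _ _ _ (htm k.le_succ)]
        rintro _ ⟨s, hs, rfl⟩
        exact hi hs
      have h2 := htrans _ _ _ _ _ ih h1
      rw [← Path.Homotopic.Quotient.mk_trans] at h2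
      rwa [Path.Homotopic.Quotient.eq.mpr ⟨Path.Homotopy.subpathTransSubpath γ _ _ _⟩] at h2
  have h := key n
  rw [ht0, hn n le_rfl, Path.subpath_zero_one] at h
  have aux : ∀ (x' y' : Y) (hx : x' = x) (hy : y' = y),
      P x' y' (Path.Homotopic.Quotient.mk (γ.cast hx hy)) →
      P x y (Path.Homotopic.Quotient.mk γ) := by
    rintro _ _ rfl rfl h
    exact h
  exact aux _ _ _ _ h

/-! ### Simplicial cocycles -/

namespace AbstractSimplicialComplex

variable {V : Type*} (K : AbstractSimplicialComplex V)

/-- The vertices `a`, `b`, `c` (not necessarily distinct) lie in a common simplex. -/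
def Spans (a b c : V) : Prop := ∃ s ∈ K.faces, a ∈ s ∧ b ∈ s ∧ c ∈ s

/-- The vertices `a`, `b` (not necessarily distinct) lie in a common simplex. -/
def Joined (a b : V) : Prop := ∃ s ∈ K.faces, a ∈ s ∧ b ∈ s

/-- A labelling of pairs of vertices that is multiplicative on the simplices of `K`. -/
def IsCocycle {H : Type*} [Group H] (ℓ : V → V → H) : Prop :=
  ∀ a b c, K.Spans a b c → ℓ a b * ℓ b c = ℓ a c

variable {K}

theorem Joined.symm {a b : V} (h : K.Joined a b) : K.Joined b a := by
  obtain ⟨s, hs, ha, hb⟩ := h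
  exact ⟨s, hs, hb, ha⟩

theorem joined_self (a : V) : K.Joined a a :=
  ⟨{a}, K.singleton_mem a, by simp, by simp⟩

theorem mem_faces_of_subset {s t : Finset V} (hs : s ∈ K.faces) (hts : t ⊆ s) (ht : t.Nonempty) :
    t ∈ K.faces :=
  (K.isRelLowerSet_faces hs).2 hts ht

theorem nonempty_of_mem_faces {s : Finset V} (hs : s ∈ K.faces) : s.Nonempty :=
  (K.isRelLowerSet_faces hs).1

theorem spans_iff [DecidableEq V] {a b c : V} : K.Spans a b c ↔ {a, b, c} ∈ K.faces := by
  constructor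
  · rintro ⟨s, hs, ha, hb, hc⟩
    refine mem_faces_of_subset hs ?_ ⟨a, by simp⟩
    intro x hx
    simp only [Finset.mem_insert, Finset.mem_singleton] at hx
    rcases hx with rfl | rfl | rfl <;> assumption
  · intro h
    exact ⟨_, h, by simp, by simp, by simp⟩

theorem joined_iff [DecidableEq V] {a b : V} : K.Joined a b ↔ {a, b} ∈ K.faces := by
  constructor
  · rintro ⟨s, hs, ha, hb⟩
    refine mem_faces_of_subset hs ?_ ⟨a, by simp⟩
    intro x hx
    simp only [Finset.mem_insert, Finset.mem_singleton] at hx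
    rcases hx with rfl | rfl <;> assumption
  · intro h
    exact ⟨_, h, by simp, by simp⟩

namespace IsCocycle

variable {H : Type*} [Group H] {ℓ : V → V → H}

theorem self (h : K.IsCocycle ℓ) (a : V) : ℓ a a = 1 := by
  have := h a a a ⟨{a}, K.singleton_mem a, by simp⟩
  simpa using this

theorem mul_swap (h : K.IsCocycle ℓ) {a b : V} (hab : K.Joined a b) : ℓ a b * ℓ b a = 1 := by
  obtain ⟨s, hs, ha, hb⟩ := hab
  rw [h a b a ⟨s, hs, ha, hb, ha⟩, h.self]

theorem swap (h : K.IsCocycle ℓ) {a b : V} (hab : K.Joined a b) : ℓ b a = (ℓ a b)⁻¹ :=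
  (inv_eq_of_mul_eq_one_right (h.mul_swap hab)).symm

end IsCocycle

end AbstractSimplicialComplex

/-! ### Covering spaces and holonomy of cocycles -/

namespace FiniteTwoComplex

open AbstractSimplicialComplex

variable (X : FiniteTwoComplex)

/-- The open star of a vertex in the geometric realization. -/
def openStar (v : X.V) : Set X.realization := {x | 0 < x.1 v}

variable {X}

theorem isOpen_openStar (v : X.V) : IsOpen (X.openStar v) :=
  isOpen_lt continuous_const ((continuous_apply v).comp continuous_subtype_val)

theorem exists_mem_openStar (x : X.realization) : ∃ v, x ∈ X.openStar v := by
  by_contra! h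
  have h0 : ∀ v, x.1 v = 0 := fun v => le_antisymm (not_lt.mp (h v)) (x.2.1.1 v)
  have := x.2.1.2
  simp [h0] at this

/-- The vertices with nonvanishing coordinate at a point of the realization lie in a simplex. -/
theorem exists_face (x : X.realization) : ∃ s ∈ X.K.faces, ∀ v, x ∈ X.openStar v → v ∈ s := by
  obtain ⟨s, hs, h⟩ := x.2.2
  refine ⟨s, hs, fun v hv => ?_⟩
  by_contra hvs
  exact (ne_of_gt hv) (h v hvs)

/-- A vertex whose open star contains the given point. -/
noncomputable def index (x : X.realization) : X.V := (exists_mem_openStar x).choose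

theorem mem_openStar_index (x : X.realization) : x ∈ X.openStar (index x) :=
  (exists_mem_openStar x).choose_spec

theorem spans_of_mem {x : X.realization} {a b c : X.V} (ha : x ∈ X.openStar a)
    (hb : x ∈ X.openStar b) (hc : x ∈ X.openStar c) : X.K.Spans a b c := by
  obtain ⟨s, hs, h⟩ := exists_face x
  exact ⟨s, hs, h a ha, h b hb, h c hc⟩

section Holonomy

variable {H : Type*} [Group H] [TopologicalSpace H] [DiscreteTopology H]

/-- The principal bundle with discrete fibre `H` whose transition functions are given by a
cocycle. -/
noncomputable def cocycleBundle {ℓ : X.V → X.V → H} (hℓ : X.K.IsCocycle ℓ) :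
    FiberBundleCore X.V X.realization H where
  baseSet := X.openStar
  isOpen_baseSet := isOpen_openStar
  indexAt := index
  mem_baseSet_at := mem_openStar_index
  coordChange v w _ h := h * ℓ v w
  coordChange_self v x _ h := by simp [hℓ.self]
  continuousOn_coordChange v w := by fun_prop
  coordChange_comp i j k x hx h := by
    rw [mul_assoc, hℓ _ _ _ (spans_of_mem hx.1.1 hx.1.2 hx.2)]

theorem isCoveringMap_cocycleBundle {ℓ : X.V → X.V → H} (hℓ : X.K.IsCocycle ℓ) :
    IsCoveringMap (cocycleBundle hℓ).proj :=
  FiberBundle.isCoveringMap (F := H) (E := (cocycleBundle hℓ).Fiber)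

/-- Over the star of `v` the lift is constant in the chart of `v`. The two factors come from passing
from the chart of `index x` to that of `v`, and from there to the chart of `index y`. -/
theorem monodromy_cocycleBundle {ℓ : X.V → X.V → H} (hℓ : X.K.IsCocycle ℓ) (v : X.V)
    {x y : X.realization} (γ : Path x y) (hγ : Set.range γ ⊆ X.openStar v) (h : H) :
    (isCoveringMap_cocycleBundle hℓ).monodromy (.mk γ) ⟨⟨x, h⟩, rfl⟩ =
      ⟨⟨y, h * (ℓ (index x) v * ℓ v (index y))⟩, rfl⟩ := by
  have hγ' : ∀ t, γ t ∈ X.openStar v := fun t => hγ ⟨t, rfl⟩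
  have hx : x ∈ X.openStar v := by simpa using hγ' 0
  set Z := cocycleBundle hℓ
  let Γ : C(I, Z.TotalSpace) :=
    { toFun := fun t => (Z.localTriv v).toOpenPartialHomeomorph.symm (γ t, h * ℓ (index x) v)
      continuous_toFun := by
        have h1 := (Z.localTriv v).toOpenPartialHomeomorph.continuousOn_symm
        refine h1.comp_continuous (by fun_prop) fun t => ?_
        rw [FiberBundleCore.mem_localTriv_target]
        exact hγ' t }
  have hΓ : ∀ t, Γ t = ⟨γ t, h * ℓ (index x) v * ℓ v (index (γ t))⟩ := fun t => rfl
  have h0 : γ 0 = Z.proj (⟨x, h⟩ : Z.TotalSpace) := γ.source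
  have hlift : Γ = (isCoveringMap_cocycleBundle hℓ).liftPath γ ⟨x, h⟩ h0 := by
    refine ((isCoveringMap_cocycleBundle hℓ).eq_liftPath_iff' h0).mpr ⟨rfl, ?_⟩
    rw [hΓ, γ.source, mul_assoc, hℓ.mul_swap, mul_one]
    obtain ⟨s, hs, h⟩ := exists_face x
    exact ⟨s, hs, h _ (mem_openStar_index x), h _ hx⟩
  apply Subtype.ext
  change (isCoveringMap_cocycleBundle hℓ).liftPath γ ⟨x, h⟩ h0 1 = _
  rw [← hlift, hΓ, γ.target, mul_assoc]

end Holonomy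

/-- Holonomy along paths of a cocycle: it is multiplicative, and for a path inside an open star it
is computed by the labels. -/
theorem exists_holonomy {H : Type*} [Group H] {ℓ : X.V → X.V → H} (hℓ : X.K.IsCocycle ℓ) :
    ∃ hol : ∀ x y : X.realization, Path.Homotopic.Quotient x y → H,
      (∀ x y z p q, hol x z (p.trans q) = hol x y p * hol y z q) ∧
      ∀ v x y (γ : Path x y), Set.range γ ⊆ X.openStar v →
        hol x y (.mk γ) = ℓ (index x) v * ℓ v (index y) := by
  let _ : TopologicalSpace H := ⊥
  have : DiscreteTopology H := ⟨rfl⟩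
  -- Transition functions multiply on the right, so monodromy commutes with left multiplication and
  -- is right multiplication by one element. This form is stable under concatenation.
  have hex : ∀ (x y : X.realization) (p : Path.Homotopic.Quotient x y), ∃ g : H, ∀ h : H,
      (isCoveringMap_cocycleBundle hℓ).monodromy p ⟨⟨x, h⟩, rfl⟩ = ⟨⟨y, h * g⟩, rfl⟩ := by
    intro x y p
    refine Path.Homotopic.Quotient.induction_of_open_cover X.openStar isOpen_openStar
      exists_mem_openStar (fun x y p => ∃ g : H, ∀ h : H,
        (isCoveringMap_cocycleBundle hℓ).monodromy p ⟨⟨x, h⟩, rfl⟩ = ⟨⟨y, h * g⟩, rfl⟩)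
      (fun v x y γ hγ => ⟨_, monodromy_cocycleBundle hℓ v γ hγ⟩) ?_ p
    rintro x y z p q ⟨g, hg⟩ ⟨g', hg'⟩
    refine ⟨g * g', fun h => ?_⟩
    rw [IsCoveringMap.monodromy_trans_apply, hg, hg', mul_assoc]
  choose hol hhol using hex
  have inj : ∀ (y : X.realization) (a b : H),
      (⟨⟨y, a⟩, rfl⟩ : (cocycleBundle hℓ).proj ⁻¹' {y}) = ⟨⟨y, b⟩, rfl⟩ → a = b := by
    intro y a b hab
    exact congrArg (fun e : (cocycleBundle hℓ).proj ⁻¹' {y} => (e.1.2 : H)) hab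
  refine ⟨hol, fun x y z p q => inj z _ _ ?_, fun v x y γ hγ => inj y _ _ ?_⟩
  · rw [← one_mul (hol x z (p.trans q)), ← hhol, IsCoveringMap.monodromy_trans_apply, hhol, hhol,
      one_mul]
  · rw [← one_mul (hol x y _), ← hhol, monodromy_cocycleBundle hℓ v γ hγ, one_mul]

end FiniteTwoComplex

/-! ### The edge-path group relative to a rooted tree -/

namespace AbstractSimplicialComplex

variable {V : Type*} (K : AbstractSimplicialComplex V)

/-- `p` is the parent function of a spanning tree of the `1`-skeleton of `K`, rooted at `r`. -/
def IsRootedTree (r : V) (p : V → V) : Prop :=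
  ∃ d : V → ℕ, ∀ v, v ≠ r → K.Joined v (p v) ∧ d (p v) < d v

/-- The relations of the edge-path group of `K` relative to a rooted tree; the generators are all
pairs of vertices, those not lying in a simplex being trivial. -/
def edgeRels (r : V) (p : V → V) : Set (FreeGroup (V × V)) :=
  {w | ∃ a b c, K.Spans a b c ∧
    w = FreeGroup.of (a, b) * FreeGroup.of (b, c) * (FreeGroup.of (a, c))⁻¹} ∪
  {w | ∃ v, v ≠ r ∧ w = FreeGroup.of (v, p v)} ∪
  {w | ∃ a b, ¬ K.Joined a b ∧ w = FreeGroup.of (a, b)}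

/-- The edge-path group of `K` relative to a rooted tree. -/
abbrev EdgeGroup (r : V) (p : V → V) : Type _ := PresentedGroup (K.edgeRels r p)

/-- A cocycle that is trivial on a rooted tree and on the pairs of vertices that are not joined. -/
structure IsTreeCocycle {H : Type*} [Group H] (r : V) (p : V → V) (ℓ : V → V → H) : Prop where
  isCocycle : K.IsCocycle ℓ
  tree : ∀ v, v ≠ r → ℓ v (p v) = 1
  off : ∀ a b, ¬ K.Joined a b → ℓ a b = 1

variable {K} {r : V} {p : V → V}

theorem Spans.left {a b c : V} (h : K.Spans a b c) : K.Joined a b := by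
  obtain ⟨s, hs, ha, hb, hc⟩ := h
  exact ⟨s, hs, ha, hb⟩

theorem Spans.right {a b c : V} (h : K.Spans a b c) : K.Joined b c := by
  obtain ⟨s, hs, ha, hb, hc⟩ := h
  exact ⟨s, hs, hb, hc⟩

theorem Spans.outer {a b c : V} (h : K.Spans a b c) : K.Joined a c := by
  obtain ⟨s, hs, ha, hb, hc⟩ := h
  exact ⟨s, hs, ha, hc⟩

theorem Spans.rotate {a b c : V} (h : K.Spans a b c) : K.Spans b c a := by
  obtain ⟨s, hs, ha, hb, hc⟩ := h
  exact ⟨s, hs, hb, hc, ha⟩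

theorem Spans.swap {a b c : V} (h : K.Spans a b c) : K.Spans b a c := by
  obtain ⟨s, hs, ha, hb, hc⟩ := h
  exact ⟨s, hs, hb, ha, hc⟩

namespace EdgeGroup

variable (K r p) in
/-- The generator of the edge-path group attached to a pair of vertices. -/
def gen (a b : V) : K.EdgeGroup r p := PresentedGroup.of (a, b)

theorem isTreeCocycle_gen : K.IsTreeCocycle r p (gen K r p) where
  isCocycle a b c h := by
    have := PresentedGroup.one_of_mem (rels := K.edgeRels r p)
      (x := FreeGroup.of (a, b) * FreeGroup.of (b, c) * (FreeGroup.of (a, c))⁻¹)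
      (Or.inl (Or.inl ⟨a, b, c, h, rfl⟩))
    rw [map_mul, map_mul, map_inv] at this
    exact mul_inv_eq_one.mp this
  tree v hv := PresentedGroup.one_of_mem (rels := K.edgeRels r p)
    (Or.inl (Or.inr ⟨v, hv, rfl⟩))
  off a b h := PresentedGroup.one_of_mem (rels := K.edgeRels r p) (Or.inr ⟨a, b, h, rfl⟩)

variable {H : Type*} [Group H] {ℓ : V → V → H}

/-- The homomorphism out of the edge-path group defined by a cocycle. -/
def lift (h : K.IsTreeCocycle r p ℓ) : K.EdgeGroup r p →* H :=
  PresentedGroup.toGroup (f := fun e : V × V => ℓ e.1 e.2) <| by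
    rintro _ ((⟨a, b, c, habc, rfl⟩ | ⟨v, hv, rfl⟩) | ⟨a, b, hab, rfl⟩)
    · simp [h.isCocycle a b c habc]
    · simpa using h.tree v hv
    · simpa using h.off a b hab

@[simp]
theorem lift_gen (h : K.IsTreeCocycle r p ℓ) (a b : V) : lift h (gen K r p a b) = ℓ a b :=
  PresentedGroup.toGroup.of _

theorem hom_ext {f g : K.EdgeGroup r p →* H}
    (h : ∀ a b, f (gen K r p a b) = g (gen K r p a b)) : f = g :=
  PresentedGroup.ext fun e => h e.1 e.2

end EdgeGroup

end AbstractSimplicialComplex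

namespace Path.Homotopic.Quotient

variable {Y : Type*} [TopologicalSpace Y] {x y z : Y}

theorem symm_trans_cancel (p : Path.Homotopic.Quotient x y) (q : Path.Homotopic.Quotient y z) :
    p.symm.trans (p.trans q) = q := by
  rw [← trans_assoc, symm_trans, refl_trans]

end Path.Homotopic.Quotient

/-- A path inside a path connected subset. -/
theorem exists_path_range_subset {Y : Type*} [TopologicalSpace Y] (S : Set Y)
    [PathConnectedSpace S] {x y : Y} (hx : x ∈ S) (hy : y ∈ S) :
    ∃ γ : Path x y, Set.range γ ⊆ S := by
  refine ⟨(PathConnectedSpace.somePath (⟨x, hx⟩ : S) ⟨y, hy⟩).map continuous_subtype_val, ?_⟩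
  rintro _ ⟨t, rfl⟩
  exact Subtype.prop _

/-! ### Stars, simplices and edge paths in the realization -/

namespace FiniteTwoComplex

open AbstractSimplicialComplex

variable (X : FiniteTwoComplex)

open Classical in
/-- A vertex as a point of the realization. -/
noncomputable def vertex (v : X.V) : X.realization :=
  ⟨Pi.single v 1, single_mem_stdSimplex ℝ v, {v}, X.K.singleton_mem v, fun w hw => by
    simp only [Finset.mem_singleton] at hw
    simp [hw]⟩

/-- The closed simplex spanned by a set of vertices. -/
def closedSimplex (s : Finset X.V) : Set X.realization := {x | ∀ v, v ∉ s → x.1 v = 0}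

variable {X}

open Classical in
theorem vertex_apply (v w : X.V) : (X.vertex v).1 w = if w = v then 1 else 0 := by
  simp [vertex, Pi.single_apply]

theorem vertex_mem_openStar_iff {v w : X.V} : X.vertex v ∈ X.openStar w ↔ w = v := by
  change 0 < (X.vertex v).1 w ↔ _
  rw [vertex_apply]
  split_ifs with h <;> simp [h]

theorem vertex_mem_openStar (v : X.V) : X.vertex v ∈ X.openStar v :=
  vertex_mem_openStar_iff.mpr rfl

theorem index_vertex (v : X.V) : index (X.vertex v) = v :=
  vertex_mem_openStar_iff.mp (mem_openStar_index _)

theorem vertex_mem_closedSimplex {v : X.V} {s : Finset X.V} (h : v ∈ s) :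
    X.vertex v ∈ X.closedSimplex s := by
  intro w hw
  rw [vertex_apply, if_neg]
  rintro rfl
  exact hw h

theorem closedSimplex_mono {s t : Finset X.V} (h : s ⊆ t) :
    X.closedSimplex s ⊆ X.closedSimplex t :=
  fun _ hx v hv => hx v fun hvs => hv (h hvs)

variable (X) in
/-- A simplex containing the given point. -/
noncomputable def carrier (x : X.realization) : Finset X.V := x.2.2.choose

theorem carrier_mem (x : X.realization) : X.carrier x ∈ X.K.faces := x.2.2.choose_spec.1

theorem mem_closedSimplex_carrier (x : X.realization) : x ∈ X.closedSimplex (X.carrier x) :=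
  x.2.2.choose_spec.2

theorem mem_of_mem_openStar {x : X.realization} {s : Finset X.V} {v : X.V}
    (hx : x ∈ X.closedSimplex s) (hv : x ∈ X.openStar v) : v ∈ s := by
  by_contra hvs
  exact (ne_of_gt hv) (hx v hvs)

/-- A point of `S` shares a simplex with `a`, so the segment between them stays in the realization.
By `h₂` it stays in `S`, which is thus star convex about the vertex `a`, and contractible. -/
theorem simplyConnectedSpace_of_star (S : Set X.realization) (a : X.V) (ha : X.vertex a ∈ S)
    (h₁ : ∀ y ∈ S, ∃ s ∈ X.K.faces, a ∈ s ∧ y ∈ X.closedSimplex s)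
    (h₂ : ∀ y ∈ S, ∀ (z : X.realization) (α β : ℝ), 0 ≤ α → 0 ≤ β → α + β = 1 →
      z.1 = α • (X.vertex a).1 + β • y.1 → z ∈ S) : SimplyConnectedSpace S := by
  have hstar : StarConvex ℝ (X.vertex a).1 (Subtype.val '' S) := by
    rintro _ ⟨y, hy, rfl⟩ α β hα hβ hαβ
    obtain ⟨s, hs, has, hys⟩ := h₁ y hy
    have hz : α • (X.vertex a).1 + β • y.1 ∈ X.realization := by
      refine ⟨convex_stdSimplex ℝ _ (X.vertex a).2.1 y.2.1 hα hβ hαβ, s, hs, fun v hv => ?_⟩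
      have h1 := vertex_mem_closedSimplex has v hv
      have h2 := hys v hv
      simp [h1, h2]
    exact ⟨⟨_, hz⟩, h₂ y hy _ α β hα hβ hαβ rfl, rfl⟩
  have hc : ContractibleSpace (Subtype.val '' S : Set (X.V → ℝ)) :=
    hstar.contractibleSpace ⟨_, _, ha, rfl⟩
  have hS : ContractibleSpace S :=
    (Topology.IsEmbedding.subtypeVal.homeomorphImage S).contractibleSpace
  infer_instance

theorem simplyConnectedSpace_openStar (a : X.V) : SimplyConnectedSpace (X.openStar a) := by
  refine simplyConnectedSpace_of_star _ a (vertex_mem_openStar a)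
    (fun y hy => ⟨_, carrier_mem y, mem_of_mem_openStar (mem_closedSimplex_carrier y) hy,
      mem_closedSimplex_carrier y⟩) fun y hy z α β hα hβ hαβ hz => ?_
  have h1 : (X.vertex a).1 a = 1 := by simp [vertex_apply]
  have h2 : 0 < y.1 a := hy
  change 0 < z.1 a
  rw [hz]
  simp only [Pi.add_apply, Pi.smul_apply, smul_eq_mul, h1, mul_one]
  rcases hα.lt_or_eq with h | h
  · positivity
  · have : β = 1 := by linarith
    simp [← h, this, h2]

theorem simplyConnectedSpace_closedSimplex {s : Finset X.V} (hs : s ∈ X.K.faces) :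
    SimplyConnectedSpace (X.closedSimplex s) := by
  obtain ⟨a, ha⟩ := nonempty_of_mem_faces hs
  refine simplyConnectedSpace_of_star _ a (vertex_mem_closedSimplex ha)
    (fun y hy => ⟨s, hs, ha, hy⟩) fun y hy z α β hα hβ hαβ hz v hv => ?_
  rw [hz]
  simp [hy v hv, vertex_mem_closedSimplex ha v hv]

theorem simplyConnectedSpace_inter {s : Finset X.V} (hs : s ∈ X.K.faces) {a : X.V} (ha : a ∈ s) :
    SimplyConnectedSpace (X.closedSimplex s ∩ X.openStar a : Set X.realization) := by
  refine simplyConnectedSpace_of_star _ a ⟨vertex_mem_closedSimplex ha, vertex_mem_openStar a⟩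
    (fun y hy => ⟨s, hs, ha, hy.1⟩) fun y hy z α β hα hβ hαβ hz => ⟨fun v hv => ?_, ?_⟩
  · rw [hz]
    simp [hy.1 v hv, vertex_mem_closedSimplex ha v hv]
  · have h1 : (X.vertex a).1 a = 1 := by simp [vertex_apply]
    have h2 : 0 < y.1 a := hy.2
    change 0 < z.1 a
    rw [hz]
    simp only [Pi.add_apply, Pi.smul_apply, smul_eq_mul, h1, mul_one]
    rcases hα.lt_or_eq with h | h
    · positivity
    · have : β = 1 := by linarith
      simp [← h, this, h2]

/-- There is a path from a vertex to a point of its open star inside the star and inside the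
carrier of the point. -/
theorem exists_spoke {a : X.V} {x : X.realization} (hx : x ∈ X.openStar a) :
    ∃ γ : Path (X.vertex a) x, Set.range γ ⊆ X.closedSimplex (X.carrier x) ∩ X.openStar a := by
  have ha := mem_of_mem_openStar (mem_closedSimplex_carrier x) hx
  have := simplyConnectedSpace_inter (carrier_mem x) ha
  exact exists_path_range_subset _ ⟨vertex_mem_closedSimplex ha, vertex_mem_openStar a⟩
    ⟨mem_closedSimplex_carrier x, hx⟩

/-- A path from a vertex to a point of its open star. -/
noncomputable def spoke {a : X.V} {x : X.realization} (hx : x ∈ X.openStar a) :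
    Path (X.vertex a) x := (exists_spoke hx).choose

theorem range_spoke {a : X.V} {x : X.realization} (hx : x ∈ X.openStar a) :
    Set.range (spoke hx) ⊆ X.closedSimplex (X.carrier x) ∩ X.openStar a :=
  (exists_spoke hx).choose_spec

open Classical in
theorem exists_edgePath {a b : X.V} (h : X.K.Joined a b) :
    ∃ γ : Path (X.vertex a) (X.vertex b), Set.range γ ⊆ X.closedSimplex {a, b} := by
  have := simplyConnectedSpace_closedSimplex (joined_iff.mp h)
  exact exists_path_range_subset _ (vertex_mem_closedSimplex (by simp))
    (vertex_mem_closedSimplex (by simp))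

/-- The path along an edge. -/
noncomputable def edgePath {a b : X.V} (h : X.K.Joined a b) : Path (X.vertex a) (X.vertex b) :=
  (exists_edgePath h).choose

theorem range_edgePath {a b : X.V} (h : X.K.Joined a b) {s : Finset X.V} (ha : a ∈ s)
    (hb : b ∈ s) : Set.range (edgePath h) ⊆ X.closedSimplex s := by
  classical
  refine (exists_edgePath h).choose_spec.trans (closedSimplex_mono ?_)
  intro x hx
  simp only [Finset.mem_insert, Finset.mem_singleton] at hx
  rcases hx with rfl | rfl <;> assumption

open Path in
theorem edgePath_trans {a b c : X.V} (h : X.K.Spans a b c) :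
    (Homotopic.Quotient.mk (edgePath h.left)).trans (Homotopic.Quotient.mk (edgePath h.right)) =
      Homotopic.Quotient.mk (edgePath h.outer) := by
  obtain ⟨s, hs, ha, hb, hc⟩ := id h
  have := simplyConnectedSpace_closedSimplex hs
  rw [← Homotopic.Quotient.mk_trans]
  refine Homotopic.Quotient.mk_eq_mk_of_subset (X.closedSimplex s) _ _ ?_ (range_edgePath _ ha hc)
  rw [Path.trans_range]
  exact Set.union_subset (range_edgePath _ ha hb) (range_edgePath _ hb hc)

theorem joined_of_mem_openStar {a b : X.V} {x : X.realization} (ha : x ∈ X.openStar a)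
    (hb : x ∈ X.openStar b) : X.K.Joined a b :=
  ⟨_, carrier_mem x, mem_of_mem_openStar (mem_closedSimplex_carrier x) ha,
    mem_of_mem_openStar (mem_closedSimplex_carrier x) hb⟩

-- The spokes and the edge all lie in the closed carrier of `x`, which is simply connected. This
-- lets a path change from one star to another.
open Path in
theorem spoke_trans_symm {a b : X.V} {x : X.realization} (ha : x ∈ X.openStar a)
    (hb : x ∈ X.openStar b) (h : X.K.Joined a b) :
    (Homotopic.Quotient.mk (spoke ha)).trans (Homotopic.Quotient.mk (spoke hb)).symm =
      Homotopic.Quotient.mk (edgePath h) := by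
  have := simplyConnectedSpace_closedSimplex (carrier_mem x)
  rw [← Homotopic.Quotient.mk_symm, ← Homotopic.Quotient.mk_trans]
  refine Homotopic.Quotient.mk_eq_mk_of_subset (X.closedSimplex (X.carrier x)) _ _ ?_
    (range_edgePath _ (mem_of_mem_openStar (mem_closedSimplex_carrier x) ha)
      (mem_of_mem_openStar (mem_closedSimplex_carrier x) hb))
  rw [Path.trans_range, Path.symm_range]
  exact Set.union_subset ((range_spoke ha).trans Set.inter_subset_left)
    ((range_spoke hb).trans Set.inter_subset_left)

open Path in
theorem spoke_trans_path {a : X.V} {x y : X.realization} (hx : x ∈ X.openStar a)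
    (hy : y ∈ X.openStar a) (γ : Path x y) (hγ : Set.range γ ⊆ X.openStar a) :
    (Homotopic.Quotient.mk (spoke hx)).trans (Homotopic.Quotient.mk γ) =
      Homotopic.Quotient.mk (spoke hy) := by
  have := simplyConnectedSpace_openStar a
  rw [← Homotopic.Quotient.mk_trans]
  refine Homotopic.Quotient.mk_eq_mk_of_subset (X.openStar a) _ _ ?_
    ((range_spoke hy).trans Set.inter_subset_right)
  rw [Path.trans_range]
  exact Set.union_subset ((range_spoke hx).trans Set.inter_subset_right) hγ

open Path in
theorem spoke_vertex (a : X.V) (h : X.vertex a ∈ X.openStar a) :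
    Homotopic.Quotient.mk (spoke h) = Homotopic.Quotient.refl _ := by
  have := simplyConnectedSpace_openStar a
  refine Homotopic.Quotient.mk_eq_mk_of_subset (X.openStar a) _ (Path.refl _)
    ((range_spoke h).trans Set.inter_subset_right) ?_
  rintro _ ⟨t, rfl⟩
  exact h

open Classical in
theorem exists_mem_openStar_inter {a b : X.V} (h : X.K.Joined a b) :
    ∃ x : X.realization, x ∈ X.openStar a ∧ x ∈ X.openStar b := by
  obtain ⟨s, hs, ha, hb⟩ := h
  have hz : (1 / 2 : ℝ) • (X.vertex a).1 + (1 / 2 : ℝ) • (X.vertex b).1 ∈ X.realization := by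
    refine ⟨convex_stdSimplex ℝ _ (X.vertex a).2.1 (X.vertex b).2.1 (by norm_num) (by norm_num)
      (by norm_num), s, hs, fun v hv => ?_⟩
    simp [vertex_mem_closedSimplex ha v hv, vertex_mem_closedSimplex hb v hv]
  refine ⟨⟨_, hz⟩, ?_, ?_⟩
  · change (0 : ℝ) < 1 / 2 * (X.vertex a).1 a + 1 / 2 * (X.vertex b).1 a
    rw [vertex_apply, vertex_apply]
    split_ifs <;> norm_num at *
  · change (0 : ℝ) < 1 / 2 * (X.vertex a).1 b + 1 / 2 * (X.vertex b).1 b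
    rw [vertex_apply, vertex_apply]
    split_ifs <;> norm_num at *

open Path in
/-- The holonomy of a cocycle along an edge is its label. -/
theorem exists_holonomy_edgePath {H : Type*} [Group H] {ℓ : X.V → X.V → H}
    (hℓ : X.K.IsCocycle ℓ) :
    ∃ hol : ∀ x y : X.realization, Homotopic.Quotient x y → H,
      (∀ x y z p q, hol x z (p.trans q) = hol x y p * hol y z q) ∧
      ∀ a b (h : X.K.Joined a b), hol _ _ (.mk (edgePath h)) = ℓ a b := by
  obtain ⟨hol, hmul, hloc⟩ := exists_holonomy hℓ
  refine ⟨hol, hmul, fun a b h => ?_⟩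
  obtain ⟨x, ha, hb⟩ := exists_mem_openStar_inter h
  have h2 : Set.range (spoke hb).symm ⊆ X.openStar b := by
    rw [Path.symm_range]
    exact (range_spoke hb).trans Set.inter_subset_right
  -- The edge is replaced by two spokes through a common point of both stars, since holonomy is
  -- known explicitly only inside a single star.
  rw [← spoke_trans_symm ha hb, hmul, hloc a _ _ _ ((range_spoke ha).trans Set.inter_subset_right),
    ← Homotopic.Quotient.mk_symm, hloc b _ _ _ h2, index_vertex, index_vertex, hℓ.self,
      hℓ.self, one_mul,
    mul_one, hℓ _ _ _ (spans_of_mem ha (mem_openStar_index x) hb)]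

end FiniteTwoComplex

/-! ### The edge-path group is the fundamental group -/

namespace FiniteTwoComplex

open AbstractSimplicialComplex Path

variable {X : FiniteTwoComplex}

section

variable {r : X.V} {p : X.V → X.V} {d : X.V → ℕ}

open Classical in
/-- The path from the root to a vertex along a rooted tree. -/
noncomputable def treePath (h : ∀ v, v ≠ r → X.K.Joined v (p v) ∧ d (p v) < d v) (v : X.V) :
    Homotopic.Quotient (X.vertex r) (X.vertex v) :=
  if hv : v = r then hv ▸ Homotopic.Quotient.refl _
  else (treePath h (p v)).trans (.mk (edgePath (h v hv).1.symm))
termination_by d v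
decreasing_by exact (h v hv).2

variable (h : ∀ v, v ≠ r → X.K.Joined v (p v) ∧ d (p v) < d v)

theorem treePath_root : treePath h r = Homotopic.Quotient.refl _ := by
  rw [treePath, dif_pos rfl]

theorem treePath_of_ne {v : X.V} (hv : v ≠ r) :
    treePath h v = (treePath h (p v)).trans (.mk (edgePath (h v hv).1.symm)) := by
  rw [treePath, dif_neg hv]

theorem pathConnectedSpace_of_tree (h : ∀ v, v ≠ r → X.K.Joined v (p v) ∧ d (p v) < d v) :
    PathConnectedSpace X.realization := by
  have key : ∀ x : X.realization, Joined (X.vertex r) x := fun x =>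
    ⟨(treePath h (index x)).out.trans (spoke (mem_openStar_index x))⟩
  exact ⟨⟨X.vertex r⟩, fun x y => (key x).symm.trans (key y)⟩

open Classical in
/-- The loop at the root that runs through the tree to `a`, along the edge to `b`, and back
(trivial if `a` and `b` are not joined). -/
noncomputable def treeLoop (a b : X.V) : FundamentalGroup X.realization (X.vertex r) :=
  if hab : X.K.Joined a b then
    (treePath h a).trans ((Homotopic.Quotient.mk (edgePath hab)).trans (treePath h b).symm)
  else Homotopic.Quotient.refl _

theorem treeLoop_of_joined {a b : X.V} (hab : X.K.Joined a b) : treeLoop h a b =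
    (treePath h a).trans ((Homotopic.Quotient.mk (edgePath hab)).trans (treePath h b).symm) :=
  dif_pos hab

theorem treeLoop_of_not_joined {a b : X.V} (hab : ¬ X.K.Joined a b) :
    treeLoop h a b = Homotopic.Quotient.refl _ :=
  dif_neg hab

theorem edgePath_trans_swap {a b : X.V} (hab : X.K.Joined a b) :
    (Homotopic.Quotient.mk (edgePath hab)).trans (Homotopic.Quotient.mk (edgePath hab.symm)) =
      Homotopic.Quotient.refl _ := by
  obtain ⟨s, hs, ha, hb⟩ := id hab
  have := simplyConnectedSpace_closedSimplex hs
  rw [← Homotopic.Quotient.mk_trans]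
  refine Homotopic.Quotient.mk_eq_mk_of_subset (X.closedSimplex s) _ (Path.refl _) ?_ ?_
  · rw [Path.trans_range]
    exact Set.union_subset (range_edgePath _ ha hb) (range_edgePath _ hb ha)
  · rintro _ ⟨t, rfl⟩
    exact vertex_mem_closedSimplex ha

/-- Multiplication in `FundamentalGroup` reverses the order of concatenation, hence the opposite
group. -/
theorem isTreeCocycle_treeLoop :
    X.K.IsTreeCocycle r p (fun a b => MulOpposite.op (treeLoop h a b)) where
  isCocycle a b c habc := by
    rw [← MulOpposite.op_mul, FundamentalGroup.mul_def]
    congr 1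
    rw [treeLoop_of_joined h habc.left, treeLoop_of_joined h habc.right,
      treeLoop_of_joined h habc.outer, ← edgePath_trans habc]
    simp only [Homotopic.Quotient.trans_assoc, Homotopic.Quotient.symm_trans_cancel]
  tree v hv := by
    rw [treeLoop_of_joined h (h v hv).1, treePath_of_ne h hv]
    simp only [Homotopic.Quotient.trans_assoc]
    rw [← Homotopic.Quotient.trans_assoc (Homotopic.Quotient.mk _) (Homotopic.Quotient.mk _),
      edgePath_trans_swap, Homotopic.Quotient.refl_trans, Homotopic.Quotient.trans_symm]
    rfl
  off a b hab := by
    rw [treeLoop_of_not_joined h hab]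
    rfl

/-- The homomorphism from the edge-path group to the fundamental group of the realization. -/
noncomputable def edgeGroupHom :
    X.K.EdgeGroup r p →* (FundamentalGroup X.realization (X.vertex r))ᵐᵒᵖ :=
  EdgeGroup.lift (isTreeCocycle_treeLoop h)

/-- Holonomy of the universal cocycle `EdgeGroup.gen` is a left inverse: it is trivial on tree
paths, so a tree loop is sent back to its generator. -/
theorem edgeGroupHom_injective : Function.Injective (edgeGroupHom h) := by
  obtain ⟨hol, hmul, hedge⟩ :=
    exists_holonomy_edgePath (EdgeGroup.isTreeCocycle_gen (K := X.K) (r := r) (p := p)).isCocycle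
  have hrefl : ∀ x, hol x x (Homotopic.Quotient.refl x) = 1 := fun x => by
    have := hmul x x x (Homotopic.Quotient.refl x) (Homotopic.Quotient.refl x)
    rw [Homotopic.Quotient.refl_trans] at this
    simpa using this
  have hsymm : ∀ x y q, hol y x q.symm = (hol x y q)⁻¹ := fun x y q => by
    rw [eq_inv_iff_mul_eq_one, ← hmul, Homotopic.Quotient.symm_trans, hrefl]
  have htree : ∀ n v, d v ≤ n → hol _ _ (treePath h v) = 1 := by
    intro n
    induction n using Nat.strong_induction_on with
    | _ n ih =>
      intro v hvn
      by_cases hv : v = r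
      · subst hv
        rw [treePath_root, hrefl]
      · rw [treePath_of_ne h hv, hmul, hedge, ih _ ((h v hv).2.trans_le hvn) _ le_rfl, one_mul,
          EdgeGroup.isTreeCocycle_gen.isCocycle.swap (h v hv).1,
          EdgeGroup.isTreeCocycle_gen.tree v hv,
          inv_one]
  let Φ : (FundamentalGroup X.realization (X.vertex r))ᵐᵒᵖ →* X.K.EdgeGroup r p :=
    { toFun := fun q => hol _ _ q.unop
      map_one' := hrefl _
      map_mul' := fun a b => hmul _ _ _ _ _ }
  have hΦ : Φ.comp (edgeGroupHom h) = MonoidHom.id _ := by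
    refine EdgeGroup.hom_ext fun a b => ?_
    change hol _ _ (edgeGroupHom h (EdgeGroup.gen X.K r p a b)).unop = _
    rw [edgeGroupHom, EdgeGroup.lift_gen, MulOpposite.unop_op]
    by_cases hab : X.K.Joined a b
    · rw [treeLoop_of_joined h hab, hmul, hmul, hedge, hsymm, htree _ _ le_rfl, htree _ _ le_rfl]
      simp
    · rw [treeLoop_of_not_joined h hab, hrefl, MonoidHom.id_apply,
        EdgeGroup.isTreeCocycle_gen.off a b hab]
  exact Function.LeftInverse.injective (g := Φ) fun x => DFunLike.congr_fun hΦ x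

/-- Paths that become loops in the image once closed up by tree paths are stable under concatenation
and include the edges. Spokes reduce a path inside one star to two edges. -/
theorem edgeGroupHom_surjective : Function.Surjective (edgeGroupHom h) := by
  let S : ∀ a b : X.V, Homotopic.Quotient (X.vertex a) (X.vertex b) → Prop := fun a b f =>
    ∃ e, edgeGroupHom h e = MulOpposite.op
      (show FundamentalGroup X.realization (X.vertex r) from
        (treePath h a).trans (f.trans (treePath h b).symm))
  have hS : ∀ a b c f g, S a b f → S b c g → S a c (f.trans g) := by
    rintro a b c f g ⟨e, he⟩ ⟨e', he'⟩
    refine ⟨e * e', ?_⟩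
    rw [map_mul, he, he', ← MulOpposite.op_mul, FundamentalGroup.mul_def]
    congr 1
    simp only [Homotopic.Quotient.trans_assoc, Homotopic.Quotient.symm_trans_cancel]
  have hSe : ∀ a b (hab : X.K.Joined a b), S a b (.mk (edgePath hab)) := fun a b hab =>
    ⟨EdgeGroup.gen X.K r p a b, by rw [edgeGroupHom, EdgeGroup.lift_gen, treeLoop_of_joined h hab]⟩
  have key : ∀ (x y : X.realization) (q : Homotopic.Quotient x y),
      ∀ a b (hx : x ∈ X.openStar a) (hy : y ∈ X.openStar b),
      S a b ((Homotopic.Quotient.mk (spoke hx)).trans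
        (q.trans (Homotopic.Quotient.mk (spoke hy)).symm)) := by
    intro x y q
    refine Homotopic.Quotient.induction_of_open_cover X.openStar isOpen_openStar
      exists_mem_openStar (fun x y q => ∀ a b (hx : x ∈ X.openStar a) (hy : y ∈ X.openStar b),
        S a b ((Homotopic.Quotient.mk (spoke hx)).trans
          (q.trans (Homotopic.Quotient.mk (spoke hy)).symm))) ?_ ?_ q
    · intro v x y γ hγ a b hx hy
      have hxv : x ∈ X.openStar v := by simpa using hγ ⟨0, rfl⟩
      have hyv : y ∈ X.openStar v := by simpa using hγ ⟨1, rfl⟩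
      have h1 := hS _ _ _ _ _ (hSe a v (joined_of_mem_openStar hx hxv))
        (hSe v b (joined_of_mem_openStar hyv hy))
      rw [← spoke_trans_symm hx hxv, ← spoke_trans_symm hyv hy, ← spoke_trans_path hxv hyv γ hγ]
        at h1
      simpa only [Homotopic.Quotient.trans_assoc, Homotopic.Quotient.symm_trans_cancel] using h1
    · intro x y z q q' hq hq' a b hx hz
      have h1 := hS _ _ _ _ _ (hq a _ hx (mem_openStar_index y))
        (hq' _ b (mem_openStar_index y) hz)
      simpa only [Homotopic.Quotient.trans_assoc, Homotopic.Quotient.symm_trans_cancel] using h1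
  intro q
  obtain ⟨e, he⟩ := key _ _ (show Homotopic.Quotient (X.vertex r) (X.vertex r) from q.unop) r r
    (vertex_mem_openStar r) (vertex_mem_openStar r)
  refine ⟨e, he.trans ?_⟩
  rw [spoke_vertex, treePath_root]
  apply MulOpposite.unop_injective
  rw [MulOpposite.unop_op, Homotopic.Quotient.refl_trans, Homotopic.Quotient.refl_trans]
  have hr : (Homotopic.Quotient.refl (X.vertex r)).symm = Homotopic.Quotient.refl (X.vertex r) := by
    simpa using Homotopic.Quotient.symm_trans (Homotopic.Quotient.refl (X.vertex r))
  rw [hr, Homotopic.Quotient.trans_refl, Homotopic.Quotient.trans_refl]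

end

/-- The fundamental group of the realization of a complex is its edge-path group. -/
theorem hasFundamentalGroup_iff {r : X.V} {p : X.V → X.V} (h : X.K.IsRootedTree r p) {G : Type*}
    [Group G] : X.HasFundamentalGroup G ↔ Nonempty (X.K.EdgeGroup r p ≃* G) := by
  obtain ⟨d, hd⟩ := h
  let e : X.K.EdgeGroup r p ≃* FundamentalGroup X.realization (X.vertex r) :=
    (MulEquiv.ofBijective (edgeGroupHom hd)
      ⟨edgeGroupHom_injective hd, edgeGroupHom_surjective hd⟩).trans
      (MulEquiv.inv' (FundamentalGroup X.realization (X.vertex r))).symm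
  have hc := pathConnectedSpace_of_tree hd
  constructor
  · rintro ⟨-, x, ⟨f⟩⟩
    exact ⟨e.trans ((FundamentalGroup.fundamentalGroupMulEquivOfPathConnected _ x).trans f)⟩
  · rintro ⟨f⟩
    exact ⟨hc, X.vertex r, ⟨e.symm.trans f⟩⟩

/-- In a complex with connected realization any two vertices are joined by an edge path. -/
theorem reflTransGen_joined (hc : PathConnectedSpace X.realization) (v r : X.V) :
    Relation.ReflTransGen X.K.Joined v r := by
  -- The stars of the vertices that reach `r` and the stars of the others are disjoint open sets
  -- covering a connected space.
  let A : Set X.realization := ⋃ a ∈ {a | Relation.ReflTransGen X.K.Joined a r}, X.openStar a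
  let B : Set X.realization := ⋃ a ∈ {a | ¬ Relation.ReflTransGen X.K.Joined a r}, X.openStar a
  have hAB : A = Bᶜ := by
    ext x
    simp only [A, B, Set.mem_iUnion, Set.mem_compl_iff, not_exists, Set.mem_ofPred_eq]
    constructor
    · rintro ⟨a, ha, hxa⟩ b hb hxb
      exact hb (ha.head (joined_of_mem_openStar hxb hxa))
    · intro hx
      refine ⟨index x, ?_, mem_openStar_index x⟩
      by_contra hn
      exact hx _ hn (mem_openStar_index x)
  have hA : IsOpen A := isOpen_biUnion fun a _ => isOpen_openStar a
  have hB : IsOpen B := isOpen_biUnion fun a _ => isOpen_openStar a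
  have hcl : IsClopen A := ⟨hAB ▸ hB.isClosed_compl, hA⟩
  have hr : X.vertex r ∈ A :=
    Set.mem_biUnion (show r ∈ {a | Relation.ReflTransGen X.K.Joined a r} from .refl)
      (vertex_mem_openStar r)
  have hv : X.vertex v ∈ A := by
    rw [hcl.eq_univ ⟨_, hr⟩]
    trivial
  simp only [A, Set.mem_iUnion] at hv
  obtain ⟨a, ha, hva⟩ := hv
  rwa [vertex_mem_openStar_iff.mp hva] at ha

end FiniteTwoComplex

/-! ### Presentations from spanning trees -/

/-- If the root can be reached from all vertices, then there is a spanning tree with this root that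
contains all the edges at the root. -/
theorem AbstractSimplicialComplex.exists_isRootedTree {V : Type*}
    {K : AbstractSimplicialComplex V} {r : V} (hc : ∀ v, Relation.ReflTransGen K.Joined v r) :
    ∃ p, K.IsRootedTree r p ∧ ∀ v, v ≠ r → K.Joined v r → p v = r := by
  let Γ : SimpleGraph V := SimpleGraph.fromRel K.Joined
  have hadj : ∀ a b, Γ.Adj a b ↔ a ≠ b ∧ K.Joined a b := fun a b => by
    rw [SimpleGraph.fromRel_adj]
    exact and_congr_right fun _ => ⟨fun h => h.elim id fun h => h.symm, Or.inl⟩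
  have hreach : ∀ v, Γ.Reachable v r := by
    intro v
    induction hc v using Relation.ReflTransGen.head_induction_on with
    | refl => exact .refl r
    | @head a b hab _ ih =>
      by_cases h : a = b
      · exact h ▸ ih
      · exact (SimpleGraph.Adj.reachable ((hadj a b).mpr ⟨h, hab⟩)).trans ih
  -- The parent is the next vertex on a geodesic to the root. For a neighbour of the root its
  -- distance to the root must drop to 0, which gives the last claim.
  have hstep : ∀ v, v ≠ r → ∃ u, Γ.Adj v u ∧ Γ.dist u r < Γ.dist v r := by
    intro v hv
    obtain ⟨w, hw⟩ := (hreach v).exists_walk_length_eq_dist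
    cases w with
    | nil => exact absurd rfl hv
    | cons hadj' q =>
      rw [SimpleGraph.Walk.length_cons] at hw
      exact ⟨_, hadj', by have := SimpleGraph.dist_le q; omega⟩
  classical
  choose! p hp using hstep
  refine ⟨p, ⟨fun v => Γ.dist v r, fun v hv =>
    ⟨((hadj _ _).mp (hp v hv).1).2, (hp v hv).2⟩⟩, fun v hv hvr => ?_⟩
  have h1 : Γ.dist v r = 1 := SimpleGraph.dist_eq_one_iff_adj.mpr ((hadj _ _).mpr ⟨hv, hvr⟩)
  have h2 : Γ.dist (p v) r = 0 := by have := (hp v hv).2; omega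
  exact (hreach (p v)).dist_eq_zero_iff.mp h2

theorem FreeGroup.norm_map_le {α β : Type*} [DecidableEq α] [DecidableEq β] (f : α → β)
    (x : FreeGroup α) : (FreeGroup.map f x).norm ≤ x.norm := by
  conv_lhs => rw [← FreeGroup.mk_toWord (x := x), FreeGroup.map.mk]
  exact FreeGroup.norm_mk_le.trans (by simp [FreeGroup.norm])

/-- A presentation over arbitrary finite types of generators and relators gives one indexed by
initial segments of the natural numbers. -/
theorem exists_finPresentation {G : Type*} [Group G] {α ι : Type*} [Fintype α] [DecidableEq α]
    [Fintype ι] (rel : ι → FreeGroup α) (e : PresentedGroup (Set.range rel) ≃* G) :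
    ∃ P : FinPresentation G, P.m = Fintype.card ι ∧ P.length ≤ ∑ i, (rel i).norm := by
  let ea := Fintype.equivFin α
  let ei := Fintype.equivFin ι
  have hr : FreeGroup.freeGroupCongr ea '' Set.range rel =
      Set.range (fun i => FreeGroup.freeGroupCongr ea (rel (ei.symm i))) := by
    rw [← Set.range_comp, ← ei.symm.surjective.range_comp]
    rfl
  refine ⟨⟨Fintype.card α, Fintype.card ι, _,
    (hr ▸ PresentedGroup.equivPresentedGroup (Set.range rel) ea).symm.trans e⟩, rfl, ?_⟩
  change ∑ i, (FreeGroup.freeGroupCongr ea (rel (ei.symm i))).norm ≤ _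
  rw [← ei.symm.sum_comp (fun i => (rel i).norm)]
  exact Finset.sum_le_sum fun i _ => FreeGroup.norm_map_le _ _

/-- A group presented without relators is free. -/
theorem PresentedGroup.isFreeGroup_of_isEmpty {α ι : Type*} [IsEmpty ι] (rel : ι → FreeGroup α) :
    IsFreeGroup (PresentedGroup (Set.range rel)) := by
  have h : Subgroup.normalClosure (Set.range rel) = ⊥ := by
    rw [Set.range_eq_empty, Subgroup.normalClosure_empty]
  exact IsFreeGroup.ofMulEquiv
    ((QuotientGroup.quotientMulEquivOfEq h).trans QuotientGroup.quotientBot).symm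

namespace AbstractSimplicialComplex

variable {V : Type*} {K : AbstractSimplicialComplex V}

/-- A labelling of pairs of vertices is a cocycle if it is antisymmetric and multiplicative for one
ordering of each triangle. -/
theorem isCocycle_of_triangles [DecidableEq V] {H : Type*} [Group H] {ℓ : V → V → H}
    (hself : ∀ a, ℓ a a = 1) (hswap : ∀ a b, ℓ b a = (ℓ a b)⁻¹)
    (htri : ∀ s ∈ K.faces, s.card = 3 → ∃ a b c, s = {a, b, c} ∧ ℓ a b * ℓ b c = ℓ a c) :
    K.IsCocycle ℓ := by
  intro a b c habc
  by_cases hab : a = b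
  · rw [hab, hself, one_mul]
  by_cases hbc : b = c
  · rw [hbc, hself, mul_one]
  by_cases hac : a = c
  · rw [hac, hself, hswap b c, inv_mul_cancel]
  have hcard : ({a, b, c} : Finset V).card = 3 := Finset.card_eq_three.mpr
    ⟨a, b, c, hab, hac, hbc, rfl⟩
  obtain ⟨x, y, z, hs, h⟩ := htri _ (spans_iff.mp habc) hcard
  have ha : a ∈ ({x, y, z} : Finset V) := hs ▸ by simp
  have hb : b ∈ ({x, y, z} : Finset V) := hs ▸ by simp
  have hc : c ∈ ({x, y, z} : Finset V) := hs ▸ by simp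
  simp only [Finset.mem_insert, Finset.mem_singleton] at ha hb hc
  -- The six orderings of the triangle all follow from the one given by antisymmetry.
  have hyx := hswap x y
  have hzy := hswap y z
  have hzx := hswap x z
  rw [← h, mul_inv_rev] at hzx
  rcases ha with rfl | rfl | rfl <;> rcases hb with rfl | rfl | rfl <;>
    rcases hc with rfl | rfl | rfl <;> first | contradiction | skip
  · exact h
  · rw [hzy, ← h, mul_inv_cancel_right]
  · rw [hyx, ← h, inv_mul_cancel_left]
  · rw [hzx, hyx, mul_inv_cancel_left]
  · rw [hzx, hzy, inv_mul_cancel_right]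
  · rw [hzy, hyx, hzx]

end AbstractSimplicialComplex

namespace FiniteTwoComplex

open AbstractSimplicialComplex

variable {X : FiniteTwoComplex}

/-- The fundamental group has a presentation with one relator of length at most `3` for each
triangle not containing a given vertex. -/
theorem exists_presentation_of_vertex {G : Type*} [Group G] (hX : X.HasFundamentalGroup G)
    (r : X.V) : ∃ (α : Type) (_ : Fintype α) (_ : DecidableEq α)
      (rel : {s : Finset X.V // (s ∈ X.K.faces ∧ s.card = 3) ∧ r ∉ s} → FreeGroup α),
      (∀ s, (rel s).norm ≤ 3) ∧ Nonempty (PresentedGroup (Set.range rel) ≃* G) := by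
  classical
  obtain ⟨p, hp, hstar⟩ := AbstractSimplicialComplex.exists_isRootedTree fun v =>
    reflTransGen_joined hX.1 v r
  obtain ⟨e⟩ := (hasFundamentalGroup_iff hp).mp hX
  let _ : LinearOrder X.V := LinearOrder.lift' (Fintype.equivFin X.V) (Equiv.injective _)
  -- Only these edges need generators: the others are tree edges or lie in a simplex with `r`, where
  -- they are trivial. The linear order picks one orientation of each.
  let good : X.V → X.V → Prop := fun a b =>
    X.K.Joined a b ∧ ¬ ((a ≠ r ∧ b = p a) ∨ (b ≠ r ∧ a = p b)) ∧ ¬ X.K.Spans r a b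
  let α : Type := {e : X.V × X.V // e.1 < e.2 ∧ good e.1 e.2}
  let w : X.V → X.V → FreeGroup α := fun a b =>
    if h : a < b ∧ good a b then FreeGroup.of ⟨(a, b), h⟩
    else if h : b < a ∧ good b a then (FreeGroup.of ⟨(b, a), h⟩)⁻¹ else 1
  have good_symm : ∀ a b, good a b → good b a := fun a b h =>
    ⟨h.1.symm, fun h' => h.2.1 h'.symm, fun h' => h.2.2 h'.swap.rotate⟩
  have w_lt : ∀ a b (h : a < b ∧ good a b), w a b = FreeGroup.of ⟨(a, b), h⟩ :=
    fun a b h => dif_pos h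
  have w_gt : ∀ a b (h : b < a ∧ good b a), w a b = (FreeGroup.of ⟨(b, a), h⟩)⁻¹ := fun a b h => by
    simp only [w]
    rw [dif_neg fun h' => lt_asymm h.1 h'.1, dif_pos h]
  have w_not : ∀ a b, ¬ good a b → w a b = 1 := fun a b h => by
    simp only [w]
    rw [dif_neg fun h' => h h'.2, dif_neg fun h' => h (good_symm _ _ h'.2)]
  have w_self : ∀ a, w a a = 1 := fun a => by
    simp only [w]
    rw [dif_neg fun h => lt_irrefl _ h.1, dif_neg fun h => lt_irrefl _ h.1]
  have w_swap : ∀ a b, w b a = (w a b)⁻¹ := by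
    intro a b
    by_cases h : good a b
    · rcases lt_trichotomy a b with hlt | rfl | hlt
      · rw [w_lt a b ⟨hlt, h⟩, w_gt b a ⟨hlt, h⟩]
      · rw [w_self, inv_one]
      · rw [w_gt a b ⟨hlt, good_symm _ _ h⟩, w_lt b a ⟨hlt, good_symm _ _ h⟩, inv_inv]
    · rw [w_not a b h, w_not b a fun h' => h (good_symm _ _ h'), inv_one]
  have w_norm : ∀ a b, (w a b).norm ≤ 1 := by
    intro a b
    simp only [w]
    split_ifs <;> simp
  have htri : ∀ s : {s : Finset X.V // (s ∈ X.K.faces ∧ s.card = 3) ∧ r ∉ s},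
      ∃ t : X.V × X.V × X.V, s.1 = {t.1, t.2.1, t.2.2} := fun s => by
    obtain ⟨a, b, c, -, -, -, h⟩ := Finset.card_eq_three.mp s.2.1.2
    exact ⟨(a, b, c), h⟩
  choose t ht using htri
  let rel : {s : Finset X.V // (s ∈ X.K.faces ∧ s.card = 3) ∧ r ∉ s} → FreeGroup α := fun s =>
    w (t s).1 (t s).2.1 * w (t s).2.1 (t s).2.2 * (w (t s).1 (t s).2.2)⁻¹
  refine ⟨α, inferInstance, inferInstance, rel, fun s => ?_, ⟨?_⟩⟩
  · refine (FreeGroup.norm_mul_le _ _).trans ?_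
    rw [FreeGroup.norm_inv_eq]
    exact add_le_add ((FreeGroup.norm_mul_le _ _).trans (add_le_add (w_norm _ _) (w_norm _ _)))
      (w_norm _ _)
  have hgen := EdgeGroup.isTreeCocycle_gen (K := X.K) (r := r) (p := p)
  let f : FreeGroup α →* X.K.EdgeGroup r p :=
    FreeGroup.lift fun e => EdgeGroup.gen X.K r p e.1.1 e.1.2
  -- All edges at `r` belong to the tree. In a triangle at `r` the opposite edge is then trivial as
  -- well, so such triangles impose no further relation.
  have hroot : ∀ a, X.K.Joined r a → EdgeGroup.gen X.K r p r a = 1 := by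
    intro a ha
    by_cases har : a = r
    · rw [har, hgen.isCocycle.self]
    · have := hgen.tree a har
      rw [hstar a har ha.symm] at this
      rw [hgen.isCocycle.swap ha.symm, this, inv_one]
  have hf : ∀ a b, f (w a b) = EdgeGroup.gen X.K r p a b := by
    intro a b
    by_cases h : good a b
    · rcases lt_trichotomy a b with hlt | rfl | hlt
      · rw [w_lt a b ⟨hlt, h⟩, FreeGroup.lift_apply_of]
      · rw [w_self, hgen.isCocycle.self, map_one]
      · rw [w_gt a b ⟨hlt, good_symm _ _ h⟩, map_inv, FreeGroup.lift_apply_of,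
          hgen.isCocycle.swap h.1.symm]
    · rw [w_not a b h, map_one]
      by_cases hj : X.K.Joined a b
      · by_cases hs : X.K.Spans r a b
        · have := hgen.isCocycle r a b hs
          rw [hroot a hs.left, hroot b hs.outer, one_mul] at this
          exact this.symm
        · have htree : (a ≠ r ∧ b = p a) ∨ (b ≠ r ∧ a = p b) := by
            by_contra hn
            exact h ⟨hj, hn, hs⟩
          rcases htree with ⟨har, rfl⟩ | ⟨hbr, rfl⟩
          · exact (hgen.tree a har).symm
          · rw [hgen.isCocycle.swap hj.symm, hgen.tree b hbr, inv_one]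
      · exact (hgen.off a b hj).symm
  let f' : PresentedGroup (Set.range rel) →* X.K.EdgeGroup r p :=
    PresentedGroup.toGroup (f := fun e : α => EdgeGroup.gen X.K r p e.1.1 e.1.2) <| by
      rintro _ ⟨s, rfl⟩
      change f (rel s) = 1
      rw [map_mul, map_mul, map_inv, hf, hf, hf, mul_inv_eq_one]
      refine hgen.isCocycle _ _ _ (spans_iff.mpr ?_)
      rw [← ht s]
      exact s.2.1.1
  have hℓ : X.K.IsTreeCocycle r p fun a b => PresentedGroup.mk (Set.range rel) (w a b) := by
    refine ⟨isCocycle_of_triangles (fun a => by rw [w_self, map_one])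
      (fun a b => by rw [w_swap, map_inv]) fun s hs hcard => ?_, fun v hv => ?_, fun a b hab => ?_⟩
    · by_cases hr : r ∈ s
      · obtain ⟨a, b, c, -, -, -, rfl⟩ := Finset.card_eq_three.mp hcard
        have h1 : ∀ x y, x ∈ ({a, b, c} : Finset X.V) → y ∈ ({a, b, c} : Finset X.V) →
            w x y = 1 := fun x y hx hy => w_not x y fun h => h.2.2 ⟨_, hs, hr, hx, hy⟩
        refine ⟨a, b, c, rfl, ?_⟩
        rw [h1 a b (by simp) (by simp), h1 b c (by simp) (by simp), h1 a c (by simp) (by simp),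
          map_one, mul_one]
      · refine ⟨_, _, _, ht ⟨s, ⟨hs, hcard⟩, hr⟩, ?_⟩
        have := PresentedGroup.one_of_mem (rels := Set.range rel) ⟨⟨s, ⟨hs, hcard⟩, hr⟩, rfl⟩
        rwa [map_mul, map_mul, map_inv, mul_inv_eq_one] at this
    · rw [w_not, map_one]
      exact fun h => h.2.1 (Or.inl ⟨hv, rfl⟩)
    · rw [w_not, map_one]
      exact fun h => hab h.1
  refine (MonoidHom.toMulEquiv f' (EdgeGroup.lift hℓ) ?_ ?_).trans e
  · ext x
    change EdgeGroup.lift hℓ (f' (PresentedGroup.of x)) = PresentedGroup.of x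
    rw [PresentedGroup.toGroup.of, EdgeGroup.lift_gen, w_lt _ _ x.2]
    rfl
  · refine EdgeGroup.hom_ext fun a b => ?_
    rw [MonoidHom.comp_apply, EdgeGroup.lift_gen]
    exact hf a b

end FiniteTwoComplex

/-! ### Removing triangles without changing the group -/

namespace AbstractSimplicialComplex

variable {V : Type*} {K K' : AbstractSimplicialComplex V} {r : V} {p : V → V}

theorem EdgeGroup.gen_swap (a b : V) : gen K r p b a = (gen K r p a b)⁻¹ := by
  by_cases h : K.Joined a b
  · exact isTreeCocycle_gen.isCocycle.swap h
  · rw [isTreeCocycle_gen.off a b h, isTreeCocycle_gen.off b a fun h' => h h'.symm, inv_one]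

theorem IsRootedTree.mono (h : K'.IsRootedTree r p) (hj : ∀ a b, K'.Joined a b → K.Joined a b) :
    K.IsRootedTree r p := by
  obtain ⟨d, hd⟩ := h
  exact ⟨d, fun v hv => ⟨hj _ _ (hd v hv).1, (hd v hv).2⟩⟩

theorem IsRootedTree.joined (h : K.IsRootedTree r p) {v : V} (hv : v ≠ r) : K.Joined v (p v) := by
  obtain ⟨d, hd⟩ := h
  exact (hd v hv).1

/-- The subcomplex of the simplices satisfying a property that passes to faces and holds for
vertices. -/
def restrict (K : AbstractSimplicialComplex V) (P : Finset V → Prop) (hP : ∀ v, P {v})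
    (hmono : ∀ s ∈ K.faces, ∀ t ⊆ s, P s → P t) : AbstractSimplicialComplex V where
  faces := {s | s ∈ K.faces ∧ P s}
  isRelLowerSet_faces := fun s hs => ⟨nonempty_of_mem_faces hs.1, fun t hts ht =>
    ⟨mem_faces_of_subset hs.1 hts ht, hmono s hs.1 t hts hs.2⟩⟩
  singleton_mem v := ⟨K.singleton_mem v, hP v⟩

/-- Removing an edge that lies in a single triangle, and this triangle, does not change the
edge-path group. -/
theorem nonempty_edgeGroup_equiv_collapse {a b c : V} (hab : a ≠ b) (hca : c ≠ a)
    (hcb : c ≠ b) (habc : K.Spans a b c)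
    (hfree : ∀ d, K.Spans a b d → d = a ∨ d = b ∨ d = c)
    (hK' : ∀ s, s ∈ K'.faces ↔ s ∈ K.faces ∧ ¬ (a ∈ s ∧ b ∈ s)) (hp : K'.IsRootedTree r p) :
    Nonempty (K'.EdgeGroup r p ≃* K.EdgeGroup r p) := by
  classical
  have hJ : ∀ u v, K'.Joined u v ↔ K.Joined u v ∧ ¬ (u = a ∧ v = b) ∧ ¬ (u = b ∧ v = a) := by
    intro u v
    rw [joined_iff, joined_iff, hK']
    refine and_congr_right fun _ => ?_
    simp only [Finset.mem_insert, Finset.mem_singleton]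
    grind
  have hac' : K'.Joined a c := (hJ a c).mpr ⟨habc.outer, by grind, by grind⟩
  have hcb' : K'.Joined c b := (hJ c b).mpr ⟨habc.right.symm, by grind, by grind⟩
  have hg := EdgeGroup.isTreeCocycle_gen (K := K) (r := r) (p := p)
  have hg' := EdgeGroup.isTreeCocycle_gen (K := K') (r := r) (p := p)
  have h₁ : K'.IsTreeCocycle r p fun u v =>
      if K'.Joined u v then EdgeGroup.gen K r p u v else 1 := by
    refine ⟨fun u v w h => ?_, fun v hv => ?_, fun u v h => if_neg h⟩
    · simp only [if_pos h.left, if_pos h.right, if_pos h.outer]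
      obtain ⟨s, hs, hu, hv, hw⟩ := h
      exact hg.isCocycle _ _ _ ⟨s, ((hK' s).mp hs).1, hu, hv, hw⟩
    · simp only [if_pos (hp.joined hv)]
      exact hg.tree v hv
  -- The missing edge `ab` is labelled by the detour through `c`. Every other pair keeps its
  -- generator.
  let ℓ : V → V → K'.EdgeGroup r p := fun u v =>
    if u = a ∧ v = b then EdgeGroup.gen K' r p a c * EdgeGroup.gen K' r p c b
    else if u = b ∧ v = a then EdgeGroup.gen K' r p b c * EdgeGroup.gen K' r p c a
    else EdgeGroup.gen K' r p u v
  have ℓab : ℓ a b = EdgeGroup.gen K' r p a c * EdgeGroup.gen K' r p c b := if_pos ⟨rfl, rfl⟩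
  have ℓba : ℓ b a = EdgeGroup.gen K' r p b c * EdgeGroup.gen K' r p c a :=
    (if_neg fun h => hab h.2).trans (if_pos ⟨rfl, rfl⟩)
  have ℓ_else : ∀ u v, ¬ (u = a ∧ v = b) → ¬ (u = b ∧ v = a) → ℓ u v = EdgeGroup.gen K' r p u v :=
    fun u v h h' => by
      simp only [ℓ]
      rw [if_neg h, if_neg h']
  have ℓ_joined : ∀ u v, K'.Joined u v → ℓ u v = EdgeGroup.gen K' r p u v := fun u v h =>
    ℓ_else u v ((hJ u v).mp h).2.1 ((hJ u v).mp h).2.2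
  have h₂ : K.IsTreeCocycle r p ℓ := by
    refine ⟨isCocycle_of_triangles (fun u => ?_) (fun u v => ?_) fun s hs hcard => ?_,
      fun v hv => ?_, fun u v h => ?_⟩
    · rw [ℓ_joined _ _ (joined_self u), hg'.isCocycle.self]
    · by_cases h : u = a ∧ v = b
      · rw [h.1, h.2, ℓab, ℓba, EdgeGroup.gen_swap a c, EdgeGroup.gen_swap c b, mul_inv_rev]
      · by_cases h' : u = b ∧ v = a
        · rw [h'.1, h'.2, ℓab, ℓba, EdgeGroup.gen_swap c a, EdgeGroup.gen_swap b c, mul_inv_rev]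
        · rw [ℓ_else u v h h', ℓ_else v u (fun h1 => h' h1.symm) (fun h1 => h h1.symm),
            EdgeGroup.gen_swap u v]
    · by_cases h : a ∈ s ∧ b ∈ s
      · refine ⟨a, c, b, ?_, by rw [ℓ_joined a c hac', ℓ_joined c b hcb', ℓab]⟩
        refine Finset.eq_of_subset_of_card_le (fun d hd => ?_) ?_
        · have := hfree d ⟨s, hs, h.1, h.2, hd⟩
          simp only [Finset.mem_insert, Finset.mem_singleton]
          tauto
        · rw [hcard]
          exact Finset.card_le_three
      · obtain ⟨x, y, z, -, -, -, rfl⟩ := Finset.card_eq_three.mp hcard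
        have hs' : K'.Spans x y z := spans_iff.mpr ((hK' _).mpr ⟨hs, h⟩)
        refine ⟨x, y, z, rfl, ?_⟩
        rw [ℓ_joined _ _ hs'.left, ℓ_joined _ _ hs'.right, ℓ_joined _ _ hs'.outer]
        exact hg'.isCocycle _ _ _ hs'
    · rw [ℓ_joined _ _ (hp.joined hv), hg'.tree v hv]
    · rw [ℓ_else u v, hg'.off u v fun h' => h ((hJ u v).mp h').1]
      · rintro ⟨rfl, rfl⟩
        exact h habc.left
      · rintro ⟨rfl, rfl⟩
        exact h habc.left.symm
  refine ⟨MonoidHom.toMulEquiv (EdgeGroup.lift h₁) (EdgeGroup.lift h₂)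
    (EdgeGroup.hom_ext fun u v => ?_) (EdgeGroup.hom_ext fun u v => ?_)⟩
  · rw [MonoidHom.comp_apply, EdgeGroup.lift_gen, MonoidHom.id_apply]
    split_ifs with h
    · rw [EdgeGroup.lift_gen, ℓ_joined u v h]
    · rw [map_one, hg'.off u v h]
  · rw [MonoidHom.comp_apply, EdgeGroup.lift_gen, MonoidHom.id_apply]
    by_cases h : u = a ∧ v = b
    · rw [h.1, h.2, ℓab, map_mul, EdgeGroup.lift_gen, EdgeGroup.lift_gen, if_pos hac', if_pos hcb',
        hg.isCocycle a c b habc.rotate.rotate.swap]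
    · by_cases h' : u = b ∧ v = a
      · rw [h'.1, h'.2, ℓba, map_mul, EdgeGroup.lift_gen, EdgeGroup.lift_gen, if_pos hac'.symm,
          if_pos hcb'.symm, hg.isCocycle b c a habc.rotate]
      · rw [ℓ_else u v h h', EdgeGroup.lift_gen]
        split_ifs with hj
        · rfl
        · refine (hg.off u v fun hK => hj ((hJ u v).mpr ⟨hK, h, h'⟩)).symm

/-- Removing one triangle of the boundary of a tetrahedron does not change the edge-path group. -/
theorem nonempty_edgeGroup_equiv_erase [DecidableEq V] {a b c v : V} (hab : a ≠ b) (hac : a ≠ c)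
    (hbc : b ≠ c) (hva : v ≠ a) (hvb : v ≠ b) (hvc : v ≠ c) (h₁ : K.Spans v a b)
    (h₂ : K.Spans v b c) (h₃ : K.Spans v a c)
    (hK' : ∀ s, s ∈ K'.faces ↔ s ∈ K.faces ∧ s ≠ {a, b, c}) :
    Nonempty (K'.EdgeGroup r p ≃* K.EdgeGroup r p) := by
  have hv : v ∉ ({a, b, c} : Finset V) := by simp [hva, hvb, hvc]
  have hS : ∀ x y, K.Spans v x y → K'.Spans v x y := fun x y h =>
    spans_iff.mpr ((hK' _).mpr ⟨spans_iff.mp h, fun h' => hv (h' ▸ by simp)⟩)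
  have hJ : ∀ u w, K'.Joined u w ↔ K.Joined u w := by
    intro u w
    rw [joined_iff, joined_iff, hK']
    refine and_iff_left fun h => ?_
    have h1 : ({a, b, c} : Finset V).card = 3 := Finset.card_eq_three.mpr
      ⟨a, b, c, hab, hac, hbc, rfl⟩
    have h2 := Finset.card_le_two (a := u) (b := w)
    rw [h] at h2
    omega
  have hg := EdgeGroup.isTreeCocycle_gen (K := K) (r := r) (p := p)
  have hg' := EdgeGroup.isTreeCocycle_gen (K := K') (r := r) (p := p)
  have h₁' : K'.IsTreeCocycle r p (EdgeGroup.gen K r p) := by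
    refine ⟨fun u w x h => ?_, hg.tree, fun u w h => hg.off u w fun h' => h ((hJ u w).mpr h')⟩
    obtain ⟨s, hs, hu, hw, hx⟩ := h
    exact hg.isCocycle _ _ _ ⟨s, ((hK' s).mp hs).1, hu, hw, hx⟩
  have h₂' : K.IsTreeCocycle r p (EdgeGroup.gen K' r p) := by
    refine ⟨isCocycle_of_triangles hg'.isCocycle.self EdgeGroup.gen_swap fun s hs hcard => ?_,
      hg'.tree, fun u w h => hg'.off u w fun h' => h ((hJ u w).mp h')⟩
    by_cases h : s = {a, b, c}
    · refine ⟨a, b, c, h, ?_⟩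
      -- Multiplied by the edge from `v` to `a`, the relation of the removed face follows from those
      -- of the three faces at `v`.
      apply mul_left_cancel (a := EdgeGroup.gen K' r p v a)
      rw [← mul_assoc, hg'.isCocycle _ _ _ (hS _ _ h₁), hg'.isCocycle _ _ _ (hS _ _ h₂),
        hg'.isCocycle _ _ _ (hS _ _ h₃)]
    · obtain ⟨x, y, z, -, -, -, rfl⟩ := Finset.card_eq_three.mp hcard
      exact ⟨x, y, z, rfl, hg'.isCocycle _ _ _ (spans_iff.mpr ((hK' _).mpr ⟨hs, h⟩))⟩
  refine ⟨MonoidHom.toMulEquiv (EdgeGroup.lift h₁') (EdgeGroup.lift h₂')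
    (EdgeGroup.hom_ext fun u v => ?_) (EdgeGroup.hom_ext fun u v => ?_)⟩ <;>
  rw [MonoidHom.comp_apply, EdgeGroup.lift_gen, EdgeGroup.lift_gen, MonoidHom.id_apply]

end AbstractSimplicialComplex

namespace FiniteTwoComplex

open AbstractSimplicialComplex

variable {X : FiniteTwoComplex} {G : Type*} [Group G]

/-- The number of triangles drops under passage to a subcomplex lacking some triangle. -/
theorem numTriangles_lt {K' : AbstractSimplicialComplex X.V} (hK' : ∀ s ∈ K'.faces, s.card ≤ 3)
    (hle : ∀ s ∈ K'.faces, s ∈ X.K.faces) {t : Finset X.V} (ht : t ∈ X.K.faces) (ht3 : t.card = 3)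
    (ht' : t ∉ K'.faces) :
    FiniteTwoComplex.numTriangles ⟨X.V, K', hK'⟩ < X.numTriangles := by
  classical
  refine Set.ncard_lt_ncard ⟨fun s hs => ⟨hle s hs.1, hs.2⟩, fun h => ht' (h ⟨ht, ht3⟩).1⟩
    (Set.toFinite _)

/-- A complex with an edge lying in exactly one triangle does not have the minimal number of
triangles. -/
theorem exists_numTriangles_lt_of_free_edge (hX : X.HasFundamentalGroup G) {a b c : X.V}
    (hab : a ≠ b) (hca : c ≠ a) (hcb : c ≠ b) (habc : X.K.Spans a b c)
    (hfree : ∀ d, X.K.Spans a b d → d = a ∨ d = b ∨ d = c) :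
    ∃ Y : FiniteTwoComplex, Y.HasFundamentalGroup G ∧ Y.numTriangles < X.numTriangles := by
  classical
  let K' := X.K.restrict (fun s => ¬ (a ∈ s ∧ b ∈ s))
    (fun v h => hab ((Finset.mem_singleton.mp h.1).trans (Finset.mem_singleton.mp h.2).symm))
    (fun s _ t hts h h' => h ⟨hts h'.1, hts h'.2⟩)
  have hJ : ∀ u v, X.K.Joined u v → ¬ (u = a ∧ v = b) → ¬ (u = b ∧ v = a) → K'.Joined u v := by
    intro u v h h1 h2
    refine joined_iff.mpr ⟨joined_iff.mp h, ?_⟩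
    simp only [Finset.mem_insert, Finset.mem_singleton]
    grind
  have hac' : K'.Joined a c := hJ a c habc.outer (by grind) (by grind)
  have hcb' : K'.Joined c b := hJ c b habc.right.symm (by grind) (by grind)
  have hreach : ∀ v, Relation.ReflTransGen K'.Joined v a := by
    intro v
    induction reflTransGen_joined hX.1 v a using Relation.ReflTransGen.head_induction_on with
    | refl => exact .refl
    | @head u w huw _ ih =>
      -- Only the edge `ab` is lost: starting from `a` there is nothing to do, and from `b` the
      -- detour through `c` reaches `a`.
      by_cases h1 : u = a ∧ w = b
      · rw [h1.1]
      · by_cases h2 : u = b ∧ w = a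
        · rw [h2.1]
          exact .head hcb'.symm (.single hac'.symm)
        · exact ih.head (hJ u w huw h1 h2)
  obtain ⟨p, hp, -⟩ := AbstractSimplicialComplex.exists_isRootedTree hreach
  have hp' : X.K.IsRootedTree a p := hp.mono fun u v ⟨s, hs, h⟩ => ⟨s, hs.1, h⟩
  have hd : ∀ s ∈ K'.faces, s.card ≤ 3 := fun s hs => X.card_le_three s hs.1
  obtain ⟨e⟩ := nonempty_edgeGroup_equiv_collapse hab hca hcb habc hfree
    (fun s => Iff.rfl : ∀ s, s ∈ K'.faces ↔ _) hp
  obtain ⟨f⟩ := (hasFundamentalGroup_iff hp').mp hX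
  refine ⟨⟨X.V, K', hd⟩, (hasFundamentalGroup_iff (X := ⟨X.V, K', hd⟩) hp).mpr ⟨e.trans f⟩,
    numTriangles_lt hd (fun s hs => hs.1) (spans_iff.mp habc) ?_ fun h => h.2 ⟨by simp, by simp⟩⟩
  exact Finset.card_eq_three.mpr ⟨a, b, c, hab, hca.symm, hcb.symm, rfl⟩

/-- A complex containing the boundary of a tetrahedron does not have the minimal number of
triangles. -/
theorem exists_numTriangles_lt_of_tetrahedron (hX : X.HasFundamentalGroup G) {a b c v : X.V}
    (hab : a ≠ b) (hac : a ≠ c) (hbc : b ≠ c) (hva : v ≠ a) (hvb : v ≠ b) (hvc : v ≠ c)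
    (h₀ : X.K.Spans a b c) (h₁ : X.K.Spans v a b) (h₂ : X.K.Spans v b c) (h₃ : X.K.Spans v a c) :
    ∃ Y : FiniteTwoComplex, Y.HasFundamentalGroup G ∧ Y.numTriangles < X.numTriangles := by
  classical
  have hcard : ({a, b, c} : Finset X.V).card = 3 := Finset.card_eq_three.mpr
    ⟨a, b, c, hab, hac, hbc, rfl⟩
  let K' := X.K.restrict (fun s => s ≠ {a, b, c})
    (fun v h => by rw [← h, Finset.card_singleton] at hcard; omega)
    (fun s hs t hts h h' => h (by
      rw [← h']
      exact (Finset.eq_of_subset_of_card_le hts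
        ((X.card_le_three s hs).trans (by rw [h', hcard]))).symm))
  have hd : ∀ s ∈ K'.faces, s.card ≤ 3 := fun s hs => X.card_le_three s hs.1
  obtain ⟨p, hp, -⟩ := AbstractSimplicialComplex.exists_isRootedTree fun u =>
    reflTransGen_joined hX.1 u v
  have hp' : K'.IsRootedTree v p := hp.mono fun u w h => by
    refine joined_iff.mpr ⟨joined_iff.mp h, fun h' => ?_⟩
    have h2 := Finset.card_le_two (a := u) (b := w)
    rw [h', hcard] at h2
    omega
  obtain ⟨e⟩ := nonempty_edgeGroup_equiv_erase (r := v) (p := p) hab hac hbc hva hvb hvc h₁ h₂ h₃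
    (fun s => Iff.rfl : ∀ s, s ∈ K'.faces ↔ _)
  obtain ⟨f⟩ := (hasFundamentalGroup_iff hp).mp hX
  exact ⟨⟨X.V, K', hd⟩, (hasFundamentalGroup_iff (X := ⟨X.V, K', hd⟩) hp').mpr ⟨e.trans f⟩,
    numTriangles_lt hd (fun s hs => hs.1) (spans_iff.mp h₀) hcard fun h => h.2 rfl⟩

/-- A complex with a triangle all of whose vertices lie in at most three triangles does not have
the minimal number of triangles. -/
theorem exists_numTriangles_lt (hX : X.HasFundamentalGroup G)
    (hdeg : ∀ v, {s : Finset X.V | (s ∈ X.K.faces ∧ s.card = 3) ∧ v ∈ s}.ncard ≤ 3)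
    {t : Finset X.V} (ht : t ∈ X.K.faces) (ht3 : t.card = 3) :
    ∃ Y : FiniteTwoComplex, Y.HasFundamentalGroup G ∧ Y.numTriangles < X.numTriangles := by
  classical
  by_contra hmin
  -- By minimality every edge of a triangle lies in a second triangle.
  have hedge : ∀ a b c, a ≠ b → c ≠ a → c ≠ b → X.K.Spans a b c →
      ∃ d, X.K.Spans a b d ∧ d ≠ a ∧ d ≠ b ∧ d ≠ c := by
    intro a b c hab hca hcb habc
    by_contra! h
    refine hmin (exists_numTriangles_lt_of_free_edge hX hab hca hcb habc fun d hd => ?_)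
    have := h d hd
    tauto
  have hfour : ∀ v, ∀ F : Finset (Finset X.V),
      (∀ s ∈ F, (s ∈ X.K.faces ∧ s.card = 3) ∧ v ∈ s) → F.card ≤ 3 := by
    intro v F hF
    rw [← Set.ncard_coe_finset]
    exact (Set.ncard_le_ncard hF (Set.toFinite _)).trans (hdeg v)
  have hfour' : ∀ v s₁ s₂ s₃ s₄, (∀ s ∈ ({s₁, s₂, s₃, s₄} : Finset (Finset X.V)),
      (s ∈ X.K.faces ∧ s.card = 3) ∧ v ∈ s) → s₁ ≠ s₂ → s₁ ≠ s₃ → s₁ ≠ s₄ → s₂ ≠ s₃ → s₂ ≠ s₄ →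
      s₃ = s₄ := by
    intro v s₁ s₂ s₃ s₄ h h₁₂ h₁₃ h₁₄ h₂₃ h₂₄
    by_contra h₃₄
    have := hfour v _ h
    rw [Finset.card_insert_of_notMem (by simp [h₁₂, h₁₃, h₁₄]),
      Finset.card_insert_of_notMem (by simp [h₂₃, h₂₄]),
      Finset.card_insert_of_notMem (by simp [h₃₄]), Finset.card_singleton] at this
    omega
  have htri : ∀ x y z, x ≠ y → z ≠ x → z ≠ y → X.K.Spans x y z →
      ({x, y, z} ∈ X.K.faces ∧ ({x, y, z} : Finset X.V).card = 3) ∧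
        x ∈ ({x, y, z} : Finset X.V) :=
    fun x y z hxy hzx hzy h => ⟨⟨spans_iff.mp h, Finset.card_eq_three.mpr
      ⟨x, y, z, hxy, hzx.symm, hzy.symm, rfl⟩⟩, by simp⟩
  have hne : ∀ (s t : Finset X.V) (x : X.V), x ∈ s → x ∉ t → s ≠ t := fun s t x hs ht h =>
    ht (h ▸ hs)
  -- The link of `v` is a 3-cycle: the edge `ab` continues to `d` beyond `a` and to `e` beyond `b`,
  -- and `ad` continues to `f`. At most three triangles contain `v`, so `vbe` and `vdf` coincide,
  -- whence `e = d`.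
  have hlink : ∀ v a b, v ≠ a → b ≠ v → b ≠ a → X.K.Spans v a b →
      ∃ d, d ≠ v ∧ d ≠ a ∧ d ≠ b ∧ X.K.Spans v a d ∧ X.K.Spans v b d := by
    intro v a b hva hbv hba hvab
    obtain ⟨d, hd, hdv, hda, hdb⟩ := hedge v a b hva hbv hba hvab
    obtain ⟨e, he, hev, heb, hea⟩ := hedge v b a hbv.symm hva.symm hba.symm hvab.swap.rotate
    obtain ⟨f, hf, hfv, hfd, hfa⟩ := hedge v d a hdv.symm hva.symm hda.symm hd.swap.rotate
    refine ⟨d, hdv, hda, hdb, hd, ?_⟩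
    have h := hfour' v {v, a, b} {v, a, d} {v, b, e} {v, d, f} (by
      simp only [Finset.forall_mem_insert, Finset.mem_singleton, forall_eq]
      exact ⟨htri _ _ _ hva hbv hba hvab, htri _ _ _ hva hdv hda hd,
        htri _ _ _ hbv.symm hev heb he, htri _ _ _ hdv.symm hfv hfd hf⟩)
      (hne _ _ b (by simp) (by simp [hbv, hba, hdb.symm]))
      (hne _ _ a (by simp) (by simp [hva.symm, hba.symm, hea.symm]))
      (hne _ _ a (by simp) (by simp [hva.symm, hda.symm, hfa.symm]))
      (hne _ _ a (by simp) (by simp [hva.symm, hba.symm, hea.symm]))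
      (hne _ _ a (by simp) (by simp [hva.symm, hda.symm, hfa.symm]))
    have hde : d ∈ ({v, b, e} : Finset X.V) := h ▸ by simp
    simp only [Finset.mem_insert, Finset.mem_singleton, hdv, hdb, false_or] at hde
    exact hde ▸ he
  obtain ⟨v, a, b, hva, hvb, hab, rfl⟩ := Finset.card_eq_three.mp ht3
  have hvab : X.K.Spans v a b := spans_iff.mpr ht
  obtain ⟨d, hdv, hda, hdb, hvad, hvbd⟩ := hlink v a b hva hvb.symm hab.symm hvab
  obtain ⟨e, hea, hev, heb, hve, habe⟩ := hlink a v b hva.symm hab.symm hvb.symm hvab.swap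
  -- The links of `v` and of `a` close up with the same fourth vertex: the triangles `vab`, `vad`,
  -- `vbd` already exhaust those at `v`, so `vae` is one of them. This makes `abd` the fourth face
  -- of a tetrahedron.
  have hed : e = d := by
    by_contra hed
    have h := hfour' v {v, a, b} {v, a, d} {v, b, d} {v, a, e} (by
      simp only [Finset.forall_mem_insert, Finset.mem_singleton, forall_eq]
      exact ⟨htri _ _ _ hva hvb.symm hab.symm hvab, htri _ _ _ hva hdv hda hvad,
        htri _ _ _ hvb hdv hdb hvbd, htri _ _ _ hva hev hea hve.swap⟩)
      (hne _ _ b (by simp) (by simp [hvb.symm, hab.symm, hdb.symm]))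
      (hne _ _ a (by simp) (by simp [hva.symm, hab, hda.symm]))
      (hne _ _ b (by simp) (by simp [hvb.symm, hab.symm, heb.symm]))
      (hne _ _ a (by simp) (by simp [hva.symm, hab, hda.symm]))
      (hne _ _ d (by simp) (by simp [hdv, hda, Ne.symm hed]))
    have hae : a ∈ ({v, b, d} : Finset X.V) := h ▸ by simp
    simp [hva.symm, hab, hda.symm] at hae
  subst hed
  exact hmin (exists_numTriangles_lt_of_tetrahedron hX hab hda.symm hdb.symm hva hvb hdv.symm
    habe hvab hvbd hvad)

end FiniteTwoComplex

/-! ### The upper bound -/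

theorem cComplexity_le {G : Type*} [Group G] (P : FinPresentation G) :
    cComplexity G ≤ P.length := iInf_le _ P

theorem minRelators_le {G : Type*} [Group G] (P : FinPresentation G) :
    minRelators G ≤ P.m := iInf_le (fun P : FinPresentation G => (P.m : ℕ∞)) P

theorem simplicialComplexity_le {G : Type*} [Group G] {X : FiniteTwoComplex}
    (hX : X.HasFundamentalGroup G) : simplicialComplexity G ≤ X.numTriangles := iInf₂_le X hX

theorem exists_numTriangles_eq {G : Type*} [Group G] (h : simplicialComplexity G ≠ ⊤) :
    ∃ X : FiniteTwoComplex, X.HasFundamentalGroup G ∧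
      (X.numTriangles : ℕ∞) = simplicialComplexity G := by
  have hne : Nonempty {X : FiniteTwoComplex // X.HasFundamentalGroup G} := by
    by_contra hn
    rw [not_nonempty_iff, isEmpty_subtype] at hn
    apply h
    rw [simplicialComplexity]
    simp [hn]
  obtain ⟨X, hX⟩ := ENat.exists_eq_iInf
    (fun X : {X : FiniteTwoComplex // X.HasFundamentalGroup G} => (X.1.numTriangles : ℕ∞))
  refine ⟨X.1, X.2, hX.trans ?_⟩
  rw [simplicialComplexity, iInf_subtype']

/-- The upper bound for the Matveev–Pervova complexity of a group that is not free. -/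
theorem cComplexity_le_of_not_isFreeGroup {G : Type*} [Group G] (hG : ¬ IsFreeGroup G)
    (h : simplicialComplexity G ≠ ⊤) : ∃ k l : ℕ, simplicialComplexity G = k ∧
      cComplexity G ≤ l ∧ l + 12 ≤ 3 * k := by
  classical
  obtain ⟨X, hX, hmin⟩ := exists_numTriangles_eq h
  have hmin' : ∀ Y : FiniteTwoComplex, Y.HasFundamentalGroup G →
      X.numTriangles ≤ Y.numTriangles := fun Y hY => by
    have := simplicialComplexity_le hY
    rw [← hmin] at this
    exact_mod_cast this
  have hpres : ∀ r : X.V, ∃ l : ℕ, cComplexity G ≤ l ∧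
      l + 3 * {s : Finset X.V | (s ∈ X.K.faces ∧ s.card = 3) ∧ r ∈ s}.ncard ≤
        3 * X.numTriangles ∧
      (IsEmpty {s : Finset X.V // (s ∈ X.K.faces ∧ s.card = 3) ∧ r ∉ s} → IsFreeGroup G) := by
    intro r
    obtain ⟨α, _, _, rel, hrel, ⟨e⟩⟩ := X.exists_presentation_of_vertex hX r
    obtain ⟨P, -, hP⟩ := exists_finPresentation rel e
    refine ⟨P.length, cComplexity_le P, ?_, fun hE => ?_⟩
    · have h1 : P.length ≤ 3 * {s : Finset X.V | (s ∈ X.K.faces ∧ s.card = 3) ∧ r ∉ s}.ncard := by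
        refine hP.trans ((Finset.sum_le_card_nsmul _ _ 3 fun s _ => hrel s).trans ?_)
        rw [Finset.card_univ, smul_eq_mul, mul_comm, ← Nat.card_eq_fintype_card]
        exact le_rfl
      have h2 : X.numTriangles = {s : Finset X.V | (s ∈ X.K.faces ∧ s.card = 3) ∧ r ∈ s}.ncard +
          {s : Finset X.V | (s ∈ X.K.faces ∧ s.card = 3) ∧ r ∉ s}.ncard := by
        rw [← Set.ncard_union_eq _ (Set.toFinite _) (Set.toFinite _),
          FiniteTwoComplex.numTriangles]
        · congr 1
          ext s
          by_cases hr : r ∈ s <;> simp [hr]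
        · rw [Set.disjoint_left]
          exact fun s hs hs' => hs'.2 hs.2
      omega
    · have := PresentedGroup.isFreeGroup_of_isEmpty rel
      exact IsFreeGroup.ofMulEquiv e
  -- In the first case a triangle exists, as otherwise there would be no relators and `G` would be
  -- free, and minimality is violated. In the second, a vertex in at least four triangles saves 3 ·
  -- 4 = 12 letters.
  by_cases hdeg : ∀ v, {s : Finset X.V | (s ∈ X.K.faces ∧ s.card = 3) ∧ v ∈ s}.ncard ≤ 3
  · exfalso
    obtain ⟨x⟩ := hX.1.nonempty
    obtain ⟨-, -, -, hfree⟩ := hpres (FiniteTwoComplex.index x)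
    by_cases hE : IsEmpty {s : Finset X.V //
        (s ∈ X.K.faces ∧ s.card = 3) ∧ FiniteTwoComplex.index x ∉ s}
    · exact hG (hfree hE)
    · obtain ⟨s, ⟨hs, hs3⟩, -⟩ := not_isEmpty_iff.mp hE
      obtain ⟨Y, hY, hlt⟩ := FiniteTwoComplex.exists_numTriangles_lt hX hdeg hs hs3
      exact absurd (hmin' Y hY) (not_le.mpr hlt)
  · push Not at hdeg
    obtain ⟨v, hv⟩ := hdeg
    obtain ⟨l, hl, hle, -⟩ := hpres v
    exact ⟨X.numTriangles, l, hmin.symm, hl, by omega⟩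

/-! ### Words read along subdivided polygons -/

section Words

variable {α : Type*}

/-- The vertices of the boundary of the polygon with `3 * w.length` sides attached along the
word `w`, each letter being subdivided into three edges; `none` is the base vertex. -/
def outerVertex (w : List (α × Bool)) (j : ℕ) : Option (α × Bool) :=
  if j % 3 = 0 then none else w[j / 3]?.map fun x => (x.1, if j % 3 = 1 then !x.2 else x.2)

/-- The element represented by the boundary of the polygon up to its `j`-th vertex. -/
def outerValue (w : List (α × Bool)) (j : ℕ) : FreeGroup α := FreeGroup.mk (w.take ((j + 1) / 3))

/-- The element attached to the `j`-th interior vertex of the polygon. -/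
def innerValue (w : List (α × Bool)) (j : ℕ) : FreeGroup α :=
  FreeGroup.mk (w.take ((2 * j + 2) / 3))

/-- The labels of the edges of the subdivided wedge of circles. -/
def wedgeLabel [DecidableEq α] : Option (α × Bool) → Option (α × Bool) → FreeGroup α
  | some x, some y => if x.1 = y.1 ∧ x.2 ≠ y.2 then FreeGroup.mk [y] else 1
  | _, _ => 1

theorem outerVertex_zero (w : List (α × Bool)) (t : ℕ) : outerVertex w (3 * t) = none := by
  simp [outerVertex]

theorem outerVertex_one {w : List (α × Bool)} {t : ℕ} (ht : t < w.length) :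
    outerVertex w (3 * t + 1) = some (w[t].1, !w[t].2) := by
  have h1 : (3 * t + 1) % 3 = 1 := by omega
  have h2 : (3 * t + 1) / 3 = t := by omega
  simp [outerVertex, h1, h2, ht]

theorem outerVertex_two {w : List (α × Bool)} {t : ℕ} (ht : t < w.length) :
    outerVertex w (3 * t + 2) = some w[t] := by
  have h1 : (3 * t + 2) % 3 = 2 := by omega
  have h2 : (3 * t + 2) / 3 = t := by omega
  simp [outerVertex, h1, h2, ht]

theorem exists_eq_three_mul (j : ℕ) : ∃ t, j = 3 * t ∨ j = 3 * t + 1 ∨ j = 3 * t + 2 :=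
  ⟨j / 3, by omega⟩

theorem wedgeLabel_self [DecidableEq α] (x : Option (α × Bool)) : wedgeLabel x x = 1 := by
  cases x <;> simp [wedgeLabel]

theorem wedgeLabel_none_right [DecidableEq α] (x : Option (α × Bool)) : wedgeLabel x none = 1 := by
  cases x <;> rfl

theorem wedgeLabel_swap [DecidableEq α] (x y : Option (α × Bool)) :
    wedgeLabel y x = (wedgeLabel x y)⁻¹ := by
  rcases x with - | ⟨a, ε⟩ <;> rcases y with - | ⟨b, δ⟩ <;> simp only [wedgeLabel, inv_one]
  by_cases h : a = b ∧ ε ≠ δ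
  · rw [if_pos h, if_pos ⟨h.1.symm, h.2.symm⟩, FreeGroup.inv_mk]
    obtain ⟨rfl, h⟩ := h
    have : ε = !δ := by revert h; cases ε <;> cases δ <;> simp
    simp [FreeGroup.invRev, this]
  · rw [if_neg h, if_neg fun h' => h ⟨h'.1.symm, h'.2.symm⟩, inv_one]

/-- A letter is read on the middle one of its three edges, from position 3t + 1 to 3t + 2. This
explains the prefix length `(j + 1) / 3` in `outerValue`. -/
theorem wedgeLabel_outerVertex [DecidableEq α] {w : List (α × Bool)} {j : ℕ}
    (hj : j < 3 * w.length) :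
    wedgeLabel (outerVertex w j) (outerVertex w (j + 1)) =
      (outerValue w j)⁻¹ * outerValue w (j + 1) := by
  obtain ⟨t, rfl | rfl | rfl⟩ := exists_eq_three_mul j
  · rw [outerVertex_zero, outerValue, outerValue, show (3 * t + 1 + 1) / 3 = t by omega,
      show (3 * t + 1) / 3 = t by omega, inv_mul_cancel]
    rfl
  · have ht : t < w.length := by omega
    rw [outerVertex_one ht, outerVertex_two ht, outerValue, outerValue,
      show (3 * t + 1 + 1) / 3 = t by omega, show (3 * t + 1 + 1 + 1) / 3 = t + 1 by omega,
      ← List.take_concat_get' _ _ ht, ← FreeGroup.mul_mk, inv_mul_cancel_left, wedgeLabel,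
      if_pos]
    simp
  · rw [outerValue, outerValue, show (3 * t + 2 + 1 + 1) / 3 = t + 1 by omega,
      show (3 * t + 2 + 1) / 3 = t + 1 by omega, inv_mul_cancel,
      show 3 * t + 2 + 1 = 3 * (t + 1) by omega, outerVertex_zero, wedgeLabel_none_right]

theorem outerVertex_ne_succ {w : List (α × Bool)} {j : ℕ} (hj : j < 3 * w.length) :
    outerVertex w j ≠ outerVertex w (j + 1) := by
  obtain ⟨t, rfl | rfl | rfl⟩ := exists_eq_three_mul j
  · rw [outerVertex_zero, outerVertex_one (by omega)]
    simp
  · have ht : t < w.length := by omega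
    rw [outerVertex_one ht, outerVertex_two ht]
    simp [Prod.ext_iff]
  · rw [show 3 * t + 2 + 1 = 3 * (t + 1) by omega, outerVertex_zero, outerVertex_two (by omega)]
    simp

/-- Two positions at distance 2 can be the same vertex only around the base vertex, at 3t + 2 and 3t
+ 4, and no letter is read between them. Hence `adjacentValue` is unambiguous even if the word is
not reduced. -/
theorem outerValue_eq_of_outerVertex_eq {w : List (α × Bool)} {j : ℕ} (hj : j + 1 < 3 * w.length)
    (h : outerVertex w j = outerVertex w (j + 2)) : outerValue w j = outerValue w (j + 2) := by
  obtain ⟨t, rfl | rfl | rfl⟩ := exists_eq_three_mul j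
  · rw [outerVertex_zero, outerVertex_two (by omega)] at h
    simp at h
  · rw [show 3 * t + 1 + 2 = 3 * (t + 1) by omega, outerVertex_zero,
      outerVertex_one (by omega)] at h
    simp at h
  · rw [outerValue, outerValue, show (3 * t + 2 + 2 + 1) / 3 = (3 * t + 2 + 1) / 3 by omega]

/-- The value of the boundary of the polygon at a vertex adjacent to the `j`-th interior vertex. -/
def adjacentValue [DecidableEq α] (w : List (α × Bool)) (j : ℕ)
    (v : Option (α × Bool)) : FreeGroup α :=
  if outerVertex w (2 * j) = v then outerValue w (2 * j)
  else if outerVertex w (2 * j + 1) = v then outerValue w (2 * j + 1)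
  else outerValue w (2 * j + 2)

theorem adjacentValue_outerVertex [DecidableEq α] {w : List (α × Bool)} {j m : ℕ} (h₁ : 2 * j ≤ m)
    (h₂ : m ≤ 2 * j + 2) (hm : m ≤ 3 * w.length) :
    adjacentValue w j (outerVertex w m) = outerValue w m := by
  obtain rfl | rfl | rfl : m = 2 * j ∨ m = 2 * j + 1 ∨ m = 2 * j + 2 := by omega
  · rw [adjacentValue, if_pos rfl]
  · rw [adjacentValue, if_neg (outerVertex_ne_succ (by omega)), if_pos rfl]
  · rw [adjacentValue, if_neg (outerVertex_ne_succ (j := 2 * j + 1) (by omega))]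
    split_ifs with h
    · exact outerValue_eq_of_outerVertex_eq (by omega) h
    · rfl

/-- Exactly one of 2j, 2j + 1, 2j + 2 is a multiple of 3, namely `3 * ((2 * j + 2) / 3)`. Each
interior vertex thus sees the base vertex once, and takes its value there, so that the edge to the
base is labelled 1. -/
theorem outerValue_base (w : List (α × Bool)) (j : ℕ) :
    outerValue w (3 * ((2 * j + 2) / 3)) = innerValue w j := by
  rw [outerValue, innerValue, show (3 * ((2 * j + 2) / 3) + 1) / 3 = (2 * j + 2) / 3 by omega]

theorem adjacentValue_none [DecidableEq α] {w : List (α × Bool)} {j : ℕ}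
    (hj : 2 * j + 2 < 3 * w.length + 3) :
    adjacentValue w j none = innerValue w j := by
  rw [← outerValue_base, ← outerVertex_zero w ((2 * j + 2) / 3),
    adjacentValue_outerVertex (by omega) (by omega) (by omega)]

end Words

/-! ### Complexes given by lists of triangles -/

open AbstractSimplicialComplex

namespace AbstractSimplicialComplex

section OfTriangles

variable {V : Type*} [DecidableEq V] {τ β : Type*} (base : V) (E : β → V × V)
  (T : τ → V × V × V)

/-- The complex made of a list of triangles, a list of edges, and the edges from a base vertex to
all other vertices. -/
def ofTriangles : AbstractSimplicialComplex V where
  faces := {s | s.Nonempty ∧ ((∃ v, s ⊆ {base, v}) ∨ (∃ e, s ⊆ {(E e).1, (E e).2}) ∨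
    ∃ t, s ⊆ {(T t).1, (T t).2.1, (T t).2.2})}
  isRelLowerSet_faces := fun s hs => ⟨hs.1, fun t hts ht => ⟨ht,
    hs.2.imp (fun ⟨v, hv⟩ => ⟨v, Finset.Subset.trans hts hv⟩) fun h => h.imp
      (fun ⟨v, hv⟩ => ⟨v, Finset.Subset.trans hts hv⟩)
      (fun ⟨v, hv⟩ => ⟨v, Finset.Subset.trans hts hv⟩)⟩⟩
  singleton_mem := fun v => ⟨Finset.singleton_nonempty v, Or.inl ⟨v, by simp⟩⟩

variable {base E T}

theorem card_le_three_ofTriangles : ∀ s ∈ (ofTriangles base E T).faces, s.card ≤ 3 := by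
  rintro s ⟨-, ⟨v, hv⟩ | ⟨e, he⟩ | ⟨t, ht⟩⟩
  · exact (Finset.card_le_card hv).trans (Finset.card_le_two.trans (by norm_num))
  · exact (Finset.card_le_card he).trans (Finset.card_le_two.trans (by norm_num))
  · exact (Finset.card_le_card ht).trans Finset.card_le_three

theorem exists_eq_of_mem_ofTriangles {s : Finset V} (hs : s ∈ (ofTriangles base E T).faces)
    (h3 : s.card = 3) : ∃ t, s = {(T t).1, (T t).2.1, (T t).2.2} := by
  obtain ⟨-, ⟨v, hv⟩ | ⟨e, he⟩ | ⟨t, ht⟩⟩ := hs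
  · have := (Finset.card_le_card hv).trans Finset.card_le_two
    omega
  · have := (Finset.card_le_card he).trans Finset.card_le_two
    omega
  · exact ⟨t, Finset.eq_of_subset_of_card_le ht (Finset.card_le_three.trans h3.ge)⟩

theorem joined_base (v : V) : (ofTriangles base E T).Joined v base :=
  joined_iff.mpr ⟨by simp, Or.inl ⟨v, by simp [Finset.pair_comm]⟩⟩

theorem joined_edge (e : β) : (ofTriangles base E T).Joined (E e).1 (E e).2 :=
  joined_iff.mpr ⟨by simp, Or.inr (Or.inl ⟨e, by simp⟩)⟩

theorem spans_triangle (t : τ) : (ofTriangles base E T).Spans (T t).1 (T t).2.1 (T t).2.2 :=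
  spans_iff.mpr ⟨by simp, Or.inr (Or.inr ⟨t, by simp⟩)⟩

variable (base E T) in
theorem isRootedTree_ofTriangles : (ofTriangles base E T).IsRootedTree base fun _ => base :=
  ⟨fun v => if v = base then 0 else 1, fun v hv => ⟨joined_base v, by simp [hv]⟩⟩

open Classical in
theorem isTreeCocycle_ofTriangles {H : Type*} [Group H] {ℓ : V → V → H} (hself : ∀ a, ℓ a a = 1)
    (hswap : ∀ a b, ℓ b a = (ℓ a b)⁻¹) (hbase : ∀ a, ℓ a base = 1)
    (htri : ∀ t, ℓ (T t).1 (T t).2.1 * ℓ (T t).2.1 (T t).2.2 = ℓ (T t).1 (T t).2.2) :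
    (ofTriangles base E T).IsTreeCocycle base (fun _ => base)
      fun a b => if (ofTriangles base E T).Joined a b then ℓ a b else 1 := by
  refine ⟨isCocycle_of_triangles (fun a => ?_) (fun a b => ?_) fun s hs h3 => ?_, fun v _ => ?_,
    fun a b h => if_neg h⟩
  · rw [if_pos (joined_self a), hself]
  · by_cases h : (ofTriangles base E T).Joined a b
    · rw [if_pos h, if_pos h.symm, hswap]
    · rw [if_neg h, if_neg fun h' => h h'.symm, inv_one]
  · obtain ⟨t, rfl⟩ := exists_eq_of_mem_ofTriangles hs h3
    have h := spans_triangle (base := base) (E := E) (T := T) t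
    refine ⟨_, _, _, rfl, ?_⟩
    rw [if_pos h.left, if_pos h.right, if_pos h.outer, htri]
  · rw [if_pos (joined_base v), hbase]

/-- Antisymmetry and triviality towards the base reduce the comparison to one orientation of each
listed edge and of each side of a listed triangle. -/
theorem eq_gen_of_joined {φ : V → V → (ofTriangles base E T).EdgeGroup base fun _ => base}
    (hself : ∀ a, φ a a = 1) (hswap : ∀ a b, φ b a = (φ a b)⁻¹) (hbase : ∀ a, φ a base = 1)
    (hedge : ∀ e, φ (E e).1 (E e).2 = EdgeGroup.gen _ _ _ (E e).1 (E e).2)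
    (h₁ : ∀ t, φ (T t).1 (T t).2.1 = EdgeGroup.gen _ _ _ (T t).1 (T t).2.1)
    (h₂ : ∀ t, φ (T t).2.1 (T t).2.2 = EdgeGroup.gen _ _ _ (T t).2.1 (T t).2.2)
    (h₃ : ∀ t, φ (T t).1 (T t).2.2 = EdgeGroup.gen _ _ _ (T t).1 (T t).2.2)
    {a b : V} (h : (ofTriangles base E T).Joined a b) :
    φ a b = EdgeGroup.gen (ofTriangles base E T) base (fun _ => base) a b := by
  have hg := EdgeGroup.isTreeCocycle_gen (K := (ofTriangles base E T)) (r := base)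
    (p := fun _ => base)
  have hs : ∀ {a b : V}, φ a b = EdgeGroup.gen (ofTriangles base E T) base (fun _ => base) a b →
      φ b a = EdgeGroup.gen (ofTriangles base E T) base (fun _ => base) b a := fun {a b} h => by
    rw [hswap a b, h]
    exact (EdgeGroup.gen_swap (K := (ofTriangles base E T)) a b).symm
  have h0 : ∀ a, φ a a = EdgeGroup.gen (ofTriangles base E T) base (fun _ => base) a a :=
    fun a => (hself a).trans (hg.isCocycle.self a).symm
  have hb : ∀ a, φ a base = EdgeGroup.gen (ofTriangles base E T) base (fun _ => base) a base := by
    intro a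
    by_cases hab : a = base
    · rw [hab]
      exact h0 base
    · rw [hbase]
      exact (hg.tree a hab).symm
  obtain ⟨s, hs', ha, hb'⟩ := h
  obtain ⟨-, ⟨v, hv⟩ | ⟨e, he⟩ | ⟨t, ht⟩⟩ := hs'
  · have ha := hv ha
    have hb' := hv hb'
    simp only [Finset.mem_insert, Finset.mem_singleton] at ha hb'
    rcases ha with rfl | rfl <;> rcases hb' with rfl | rfl
    exacts [h0 _, hs (hb _), hb _, h0 _]
  · have ha := he ha
    have hb' := he hb'
    simp only [Finset.mem_insert, Finset.mem_singleton] at ha hb'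
    rcases ha with rfl | rfl <;> rcases hb' with rfl | rfl
    exacts [h0 _, hedge _, hs (hedge _), h0 _]
  · have ha := ht ha
    have hb' := ht hb'
    simp only [Finset.mem_insert, Finset.mem_singleton] at ha hb'
    rcases ha with rfl | rfl | rfl <;> rcases hb' with rfl | rfl | rfl
    exacts [h0 _, h₁ _, h₃ _, hs (h₁ _), h0 _, h₂ _, hs (h₃ _), hs (h₂ _), h0 _]

end OfTriangles

end AbstractSimplicialComplex

/-! ### The triangulated presentation complex and its labels -/

section PresentationComplex

open FiniteTwoComplex

variable {α ι : Type} (w : ι → List (α × Bool))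

/-- The number of interior vertices used to triangulate the polygon of a relator. -/
def innerCount (i : ι) : ℕ := (3 * (w i).length + 1) / 2

/-- The vertices of the triangulated presentation complex. -/
abbrev PresVertex : Type := Option (α × Bool) ⊕ Σ i, Fin (innerCount w i)

/-- The indices of the triangles of the triangulated presentation complex. -/
abbrev PresTriangle : Type := Σ i, Fin (3 * (w i).length) ⊕ Fin (innerCount w i - 1) ⊕ Unit ⊕
  Fin (innerCount w i - 2)

/-- The interior vertices of the polygon of a relator. -/
def innerVertex (i : ι) (j : ℕ) : PresVertex w :=
  -- The default value is never reached from `presTriangle` when the words are nonempty.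
  if h : j < innerCount w i then Sum.inr ⟨i, j, h⟩ else Sum.inl none

/-- The triangles of the triangulated presentation complex. -/
def presTriangle : PresTriangle w → PresVertex w × PresVertex w × PresVertex w
  | ⟨i, .inl m⟩ => (innerVertex w i (m / 2), .inl (outerVertex (w i) m),
      .inl (outerVertex (w i) (m + 1)))
  | ⟨i, .inr (.inl j)⟩ => (innerVertex w i j, .inl (outerVertex (w i) (2 * j + 2)),
      innerVertex w i (j + 1))
  | ⟨i, .inr (.inr (.inl _))⟩ => (innerVertex w i (innerCount w i - 1), .inl none,
      innerVertex w i 0)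
  | ⟨i, .inr (.inr (.inr j))⟩ => (innerVertex w i 0, innerVertex w i (j + 1),
      innerVertex w i (j + 2))

/-- The edges of the triangulated presentation complex carrying the generators. -/
def presEdge (a : α) : PresVertex w × PresVertex w :=
  (.inl (some (a, false)), .inl (some (a, true)))

theorem innerValue_zero (l : List (α × Bool)) : innerValue l 0 = 1 := by
  simp [innerValue, FreeGroup.one_eq_mk]

theorem innerValue_last {w : ι → List (α × Bool)} {i : ι} (hw : w i ≠ []) :
    innerValue (w i) (innerCount w i - 1) = FreeGroup.mk (w i) := by
  have := List.length_pos_iff.mpr hw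
  rw [innerValue, List.take_of_length_le]
  unfold innerCount
  omega

theorem innerCount_pos {w : ι → List (α × Bool)} {i : ι} (hw : w i ≠ []) : 0 < innerCount w i := by
  have := List.length_pos_iff.mpr hw
  unfold innerCount
  omega

variable [DecidableEq α] [DecidableEq ι]

/-- The triangulated presentation complex. -/
def presComplex : AbstractSimplicialComplex (PresVertex w) :=
  ofTriangles (.inl none) (presEdge w) (presTriangle w)

/-- The labels of the edges of the triangulated presentation complex. -/
def presLabel : PresVertex w → PresVertex w → FreeGroup α
  | .inl u, .inl v => wedgeLabel u v
  | .inl u, .inr ⟨i, j⟩ => (adjacentValue (w i) j u)⁻¹ * innerValue (w i) j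
  | .inr ⟨i, j⟩, .inl v => (innerValue (w i) j)⁻¹ * adjacentValue (w i) j v
  | .inr ⟨i, j⟩, .inr ⟨i', j'⟩ =>
      if i = i' then (innerValue (w i) j)⁻¹ * innerValue (w i') j' else 1

variable {w}

theorem presLabel_self (a : PresVertex w) : presLabel w a a = 1 := by
  rcases a with u | ⟨i, j⟩
  · exact wedgeLabel_self u
  · simp [presLabel]

theorem presLabel_swap (a b : PresVertex w) : presLabel w b a = (presLabel w a b)⁻¹ := by
  rcases a with u | ⟨i, j⟩ <;> rcases b with v | ⟨i', j'⟩
  · exact wedgeLabel_swap u v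
  · simp [presLabel]
  · simp [presLabel]
  · by_cases h : i = i'
    · simp [presLabel, h]
    · simp [presLabel, h, Ne.symm h]

theorem presLabel_base (a : PresVertex w) : presLabel w a (.inl none) = 1 := by
  rcases a with u | ⟨i, j, hj⟩
  · exact wedgeLabel_none_right u
  · have : 2 * j + 2 < 3 * (w i).length + 3 := by
      unfold innerCount at hj
      omega
    simp [presLabel, adjacentValue_none this]

theorem presLabel_inner_outer {i : ι} {j m : ℕ} (hj : j < innerCount w i) (h₁ : 2 * j ≤ m)
    (h₂ : m ≤ 2 * j + 2) (hm : m ≤ 3 * (w i).length) :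
    presLabel w (innerVertex w i j) (.inl (outerVertex (w i) m)) =
      (innerValue (w i) j)⁻¹ * outerValue (w i) m := by
  rw [innerVertex, dif_pos hj]
  simp [presLabel, adjacentValue_outerVertex h₁ h₂ hm]

theorem presLabel_inner_inner {i : ι} {j j' : ℕ} (hj : j < innerCount w i)
    (hj' : j' < innerCount w i) :
    presLabel w (innerVertex w i j) (innerVertex w i j') =
      (innerValue (w i) j)⁻¹ * innerValue (w i) j' := by
  rw [innerVertex, innerVertex, dif_pos hj, dif_pos hj']
  simp [presLabel]

theorem presLabel_outer {i : ι} {m : ℕ} (hm : m < 3 * (w i).length) :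
    presLabel w (.inl (outerVertex (w i) m)) (.inl (outerVertex (w i) (m + 1))) =
      (outerValue (w i) m)⁻¹ * outerValue (w i) (m + 1) :=
  wedgeLabel_outerVertex hm

/-- The product of the labels along a triangle is trivial or a relator. -/
theorem presLabel_triangle (hw : ∀ i, w i ≠ []) (t : PresTriangle w) :
    (presLabel w (presTriangle w t).1 (presTriangle w t).2.1 *
      presLabel w (presTriangle w t).2.1 (presTriangle w t).2.2 *
      (presLabel w (presTriangle w t).1 (presTriangle w t).2.2)⁻¹ = 1) ∨
    ∃ i, presLabel w (presTriangle w t).1 (presTriangle w t).2.1 *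
      presLabel w (presTriangle w t).2.1 (presTriangle w t).2.2 *
      (presLabel w (presTriangle w t).1 (presTriangle w t).2.2)⁻¹ = FreeGroup.mk (w i) := by
  rcases t with ⟨i, m | j | _ | j⟩ <;> simp only [presTriangle]
  · left
    have hm := m.2
    have hj : m.1 / 2 < innerCount w i := by unfold innerCount; omega
    rw [presLabel_inner_outer hj (by omega) (by omega) (by omega),
      presLabel_inner_outer hj (by omega) (by omega) (by omega), presLabel_outer hm]
    group
  · left
    have hj := j.2
    have h3 : 2 * innerCount w i ≤ 3 * (w i).length + 1 := by unfold innerCount; omega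
    rw [presLabel_inner_outer (by omega) (by omega) (by omega) (by omega),
      presLabel_inner_inner (by omega) (by omega), presLabel_swap (innerVertex w i (j + 1)),
      presLabel_inner_outer (by omega) (by omega) (by omega) (by omega)]
    group
  -- The two edges to the base are trivial, and the edge from the last to the first interior vertex
  -- carries the inverse of the whole word. In all other triangles the labels are quotients of
  -- values at the corners and cancel.
  · right
    have := List.length_pos_iff.mpr (hw i)
    have h0 : 0 < innerCount w i := by unfold innerCount; omega
    refine ⟨i, ?_⟩
    rw [presLabel_base, presLabel_swap _ (Sum.inl none), presLabel_base,
      presLabel_inner_inner (by omega) h0, innerValue_zero, innerValue_last (hw i)]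
    group
  · left
    have hj := j.2
    rw [presLabel_inner_inner (by omega) (by omega), presLabel_inner_inner (by omega) (by omega),
      presLabel_inner_inner (by omega) (by omega)]
    group

end PresentationComplex

/-! ### The group of the triangulated presentation complex -/

open AbstractSimplicialComplex

section PresentationComplexGroup

variable {α ι : Type} [DecidableEq α] [DecidableEq ι] (w : ι → List (α × Bool))

/-- The generators of the edge-path group of the triangulated presentation complex. -/
def presGen (a b : PresVertex w) :
    (presComplex w).EdgeGroup (.inl none) fun _ => .inl none :=
  EdgeGroup.gen (presComplex w) (.inl none) (fun _ => .inl none) a b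

/-- The map from the free group on the generators of a presentation to the edge-path group of its
triangulated presentation complex. -/
def presHom : FreeGroup α →* (presComplex w).EdgeGroup (.inl none) fun _ => .inl none :=
  FreeGroup.lift fun a => presGen w (.inl (some (a, false))) (.inl (some (a, true)))

variable {w}

theorem presGen_swap (a b : PresVertex w) : presGen w b a = (presGen w a b)⁻¹ :=
  EdgeGroup.gen_swap a b

theorem presGen_triangle (t : PresTriangle w) :
    presGen w (presTriangle w t).1 (presTriangle w t).2.1 *
      presGen w (presTriangle w t).2.1 (presTriangle w t).2.2 =
    presGen w (presTriangle w t).1 (presTriangle w t).2.2 :=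
  (EdgeGroup.isTreeCocycle_gen (K := presComplex w)).isCocycle _ _ _ (spans_triangle t)

theorem presGen_self (a : PresVertex w) : presGen w a a = 1 :=
  (EdgeGroup.isTreeCocycle_gen (K := presComplex w)).isCocycle.self a

theorem presGen_base (a : PresVertex w) : presGen w a (.inl none) = 1 := by
  by_cases h : a = .inl none
  · rw [h, presGen_self]
  · exact (EdgeGroup.isTreeCocycle_gen (K := presComplex w)).tree a h

theorem presHom_mk_singleton (x : α × Bool) :
    presHom w (FreeGroup.mk [x]) = presGen w (.inl (some (x.1, !x.2))) (.inl (some x)) := by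
  obtain ⟨a, ε⟩ := x
  cases ε
  · rw [show FreeGroup.mk [(a, false)] = (FreeGroup.of a)⁻¹ from rfl, map_inv, presGen_swap]
    exact congrArg Inv.inv FreeGroup.lift_apply_of
  · exact FreeGroup.lift_apply_of

theorem presGen_outer {i : ι} {m : ℕ} (hm : m < 3 * (w i).length) :
    presGen w (.inl (outerVertex (w i) m)) (.inl (outerVertex (w i) (m + 1))) =
      presHom w ((outerValue (w i) m)⁻¹ * outerValue (w i) (m + 1)) := by
  rw [← wedgeLabel_outerVertex hm]
  obtain ⟨t, rfl | rfl | rfl⟩ := exists_eq_three_mul m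
  · rw [outerVertex_zero, presGen_swap, presGen_base, inv_one]
    exact (map_one _).symm
  · have ht : t < (w i).length := by omega
    rw [outerVertex_one ht, outerVertex_two ht, wedgeLabel, if_pos (by simp),
      presHom_mk_singleton]
  · rw [show 3 * t + 2 + 1 = 3 * (t + 1) by omega, outerVertex_zero, wedgeLabel_none_right,
      presGen_base, map_one]

/-- Multiplied by the inverse of the boundary value, the generator from the `j`-th interior vertex
to a boundary vertex is unchanged along the triangles at that interior vertex. At the base vertex
the generator is a tree edge, which determines the constant. -/
theorem presGen_inner_outer {i : ι} {j m : ℕ} (hj : j < innerCount w i) (h₁ : 2 * j ≤ m)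
    (h₂ : m ≤ 2 * j + 2) (hm : m ≤ 3 * (w i).length) :
    presGen w (innerVertex w i j) (.inl (outerVertex (w i) m)) =
      presHom w ((innerValue (w i) j)⁻¹ * outerValue (w i) m) := by
  have hstep : ∀ m, m < 3 * (w i).length → m / 2 = j →
      presGen w (innerVertex w i j) (.inl (outerVertex (w i) m)) *
        (presHom w (outerValue (w i) m))⁻¹ =
      presGen w (innerVertex w i j) (.inl (outerVertex (w i) (m + 1))) *
        (presHom w (outerValue (w i) (m + 1)))⁻¹ := by
    intro m hm hmj
    have h : presGen w (innerVertex w i (m / 2)) (.inl (outerVertex (w i) m)) *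
        presGen w (.inl (outerVertex (w i) m)) (.inl (outerVertex (w i) (m + 1))) =
        presGen w (innerVertex w i (m / 2)) (.inl (outerVertex (w i) (m + 1))) :=
      presGen_triangle ⟨i, .inl ⟨m, hm⟩⟩
    rw [hmj, presGen_outer hm, map_mul, map_inv] at h
    rw [← h]
    group
  have hj' : 2 * j < 3 * (w i).length := by unfold innerCount at hj; omega
  have h0 := hstep (2 * j) hj' (by omega)
  have hb : presGen w (innerVertex w i j) (.inl (outerVertex (w i) (3 * ((2 * j + 2) / 3)))) *
      (presHom w (outerValue (w i) (3 * ((2 * j + 2) / 3))))⁻¹ =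
      (presHom w (innerValue (w i) j))⁻¹ := by
    rw [outerVertex_zero, presGen_base, outerValue_base, one_mul]
  have hall : presGen w (innerVertex w i j) (.inl (outerVertex (w i) m)) *
      (presHom w (outerValue (w i) m))⁻¹ = (presHom w (innerValue (w i) j))⁻¹ := by
    -- Nine cases: the position of the base vertex among the three neighbours, and the position of
    -- `m`.
    obtain hn | hn | hn : 3 * ((2 * j + 2) / 3) = 2 * j ∨ 3 * ((2 * j + 2) / 3) = 2 * j + 1 ∨
        3 * ((2 * j + 2) / 3) = 2 * j + 2 := by omega
    all_goals
      rw [hn] at hb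
      obtain rfl | rfl | rfl : m = 2 * j ∨ m = 2 * j + 1 ∨ m = 2 * j + 2 := by omega
    · exact hb
    · exact h0.symm.trans hb
    · exact (hstep (2 * j + 1) (by omega) (by omega)).symm.trans (h0.symm.trans hb)
    · exact h0.trans hb
    · exact hb
    · exact (hstep (2 * j + 1) (by omega) (by omega)).symm.trans hb
    · exact h0.trans ((hstep (2 * j + 1) (by omega) (by omega)).trans hb)
    · exact (hstep (2 * j + 1) (by omega) (by omega)).trans hb
    · exact hb
  rw [map_mul, map_inv, ← hall]
  group

theorem presGen_inner_succ {i : ι} {j : ℕ} (hj : j + 1 < innerCount w i) :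
    presGen w (innerVertex w i j) (innerVertex w i (j + 1)) =
      presHom w ((innerValue (w i) j)⁻¹ * innerValue (w i) (j + 1)) := by
  have h : presGen w (innerVertex w i j) (.inl (outerVertex (w i) (2 * j + 2))) *
      presGen w (.inl (outerVertex (w i) (2 * j + 2))) (innerVertex w i (j + 1)) =
      presGen w (innerVertex w i j) (innerVertex w i (j + 1)) :=
    presGen_triangle ⟨i, .inr (.inl ⟨j, by omega⟩)⟩
  have h3 : 2 * innerCount w i ≤ 3 * (w i).length + 1 := by unfold innerCount; omega
  rw [← h, presGen_swap (innerVertex w i (j + 1)),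
    presGen_inner_outer (by omega) (by omega) (by omega) (by omega),
    presGen_inner_outer hj (by omega) (by omega) (by omega), ← map_inv, ← map_mul]
  congr 1
  group

/-- Induction along the fan of triangles from interior vertex 0, which fills the inner cycle. -/
theorem presGen_inner_zero {i : ι} {j : ℕ} (hj : j < innerCount w i) :
    presGen w (innerVertex w i 0) (innerVertex w i j) =
      presHom w ((innerValue (w i) 0)⁻¹ * innerValue (w i) j) := by
  induction j with
  | zero => rw [presGen_self, inv_mul_cancel, map_one]
  | succ j ih =>
    rcases j with - | j
    · exact presGen_inner_succ hj
    · have h : presGen w (innerVertex w i 0) (innerVertex w i (j + 1)) *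
          presGen w (innerVertex w i (j + 1)) (innerVertex w i (j + 2)) =
          presGen w (innerVertex w i 0) (innerVertex w i (j + 2)) :=
        presGen_triangle ⟨i, .inr (.inr (.inr ⟨j, by omega⟩))⟩
      rw [← h, ih (by omega), presGen_inner_succ hj, ← map_mul]
      congr 1
      group

theorem presGen_closing (i : ι) :
    presGen w (innerVertex w i (innerCount w i - 1)) (innerVertex w i 0) = 1 := by
  have h : presGen w (innerVertex w i (innerCount w i - 1)) (.inl none) *
      presGen w (.inl none) (innerVertex w i 0) =
      presGen w (innerVertex w i (innerCount w i - 1)) (innerVertex w i 0) :=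
    presGen_triangle ⟨i, .inr (.inr (.inl ()))⟩
  rw [← h, presGen_swap _ (.inl none), presGen_base, presGen_base, inv_one, mul_one]

/-- The edge from the first to the last interior vertex carries the whole word by the fan, but it is
trivial by the closing triangle at the base. -/
theorem presHom_relator {i : ι} (hw : w i ≠ []) : presHom w (FreeGroup.mk (w i)) = 1 := by
  have h0 := innerCount_pos hw
  have h := presGen_inner_zero (show innerCount w i - 1 < innerCount w i by omega)
  rw [innerValue_zero, innerValue_last hw, inv_one, one_mul, presGen_swap, presGen_closing,
    inv_one] at h
  exact h.symm

theorem presHom_presLabel (hw : ∀ i, w i ≠ []) {a b : PresVertex w}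
    (h : (presComplex w).Joined a b) : presHom w (presLabel w a b) = presGen w a b := by
  refine eq_gen_of_joined (base := Sum.inl none) (E := presEdge w) (T := presTriangle w)
    (φ := fun a b => presHom w (presLabel w a b)) (fun a => ?_) (fun a b => ?_) (fun a => ?_)
    (fun x => ?_) (fun t => ?_) (fun t => ?_) (fun t => ?_) h
  · rw [presLabel_self, map_one]
    rfl
  · rw [presLabel_swap, map_inv]
    rfl
  · rw [presLabel_base, map_one]
    rfl
  · change presHom w (wedgeLabel (some (x, false)) (some (x, true))) =
      presGen w (.inl (some (x, false))) (.inl (some (x, true)))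
    rw [wedgeLabel, if_pos (by simp), presHom_mk_singleton]
    rfl
  · change _ = presGen w _ _
    rcases t with ⟨i, m | j | _ | j⟩ <;> simp only [presTriangle]
    · have hm := m.2
      have hj : m.1 / 2 < innerCount w i := by unfold innerCount; omega
      rw [presLabel_inner_outer hj (by omega) (by omega) (by omega),
        presGen_inner_outer hj (by omega) (by omega) (by omega)]
    · have hj := j.2
      have h3 : 2 * innerCount w i ≤ 3 * (w i).length + 1 := by unfold innerCount; omega
      rw [presLabel_inner_outer (by omega) (by omega) (by omega) (by omega),
        presGen_inner_outer (by omega) (by omega) (by omega) (by omega)]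
    · rw [presLabel_base, presGen_base, map_one]
    · have hj := j.2
      rw [presLabel_inner_inner (by omega) (by omega), presGen_inner_zero (by omega)]
  · change _ = presGen w _ _
    rcases t with ⟨i, m | j | _ | j⟩ <;> simp only [presTriangle]
    · rw [presLabel_outer m.2, presGen_outer m.2]
    · have hj := j.2
      have h3 : 2 * innerCount w i ≤ 3 * (w i).length + 1 := by unfold innerCount; omega
      rw [presLabel_swap (innerVertex w i (j + 1)), presGen_swap (innerVertex w i (j + 1)),
        presLabel_inner_outer (by omega) (by omega) (by omega) (by omega),
        presGen_inner_outer (by omega) (by omega) (by omega) (by omega), map_inv]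
    · rw [presLabel_swap _ (Sum.inl none), presGen_swap _ (Sum.inl none), presLabel_base,
        presGen_base, inv_one, inv_one, map_one]
    · have hj := j.2
      rw [presLabel_inner_inner (by omega) (by omega), presGen_inner_succ (by omega)]
  · change _ = presGen w _ _
    rcases t with ⟨i, m | j | _ | j⟩ <;> simp only [presTriangle]
    · have hm := m.2
      have hj : m.1 / 2 < innerCount w i := by unfold innerCount; omega
      rw [presLabel_inner_outer hj (by omega) (by omega) (by omega),
        presGen_inner_outer hj (by omega) (by omega) (by omega)]
    · have hj := j.2
      rw [presLabel_inner_inner (by omega) (by omega), presGen_inner_succ (by omega)]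
    · have h0 := innerCount_pos (hw i)
      rw [presGen_closing, presLabel_inner_inner (by omega) h0, innerValue_last (hw i),
        innerValue_zero, mul_one, map_inv, presHom_relator (hw i), inv_one]
    · have hj := j.2
      rw [presLabel_inner_inner (by omega) (by omega), presGen_inner_zero (by omega)]

/-- The edge-path group of the triangulated presentation complex is the presented group. -/
theorem nonempty_presComplex_equiv (hw : ∀ i, w i ≠ []) :
    Nonempty ((presComplex w).EdgeGroup (.inl none) (fun _ => .inl none) ≃*
      PresentedGroup (Set.range fun i => FreeGroup.mk (w i))) := by
  classical
  let π : FreeGroup α →* PresentedGroup (Set.range fun i => FreeGroup.mk (w i)) :=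
    PresentedGroup.mk _
  have hπ : ∀ i, π (FreeGroup.mk (w i)) = 1 := fun i => PresentedGroup.one_of_mem ⟨i, rfl⟩
  -- Modulo the relators the closing triangles multiply to 1 as well, so the labels form a cocycle,
  -- and the resulting homomorphism is inverse to the one induced by `presHom`.
  have hℓ := isTreeCocycle_ofTriangles (base := Sum.inl none) (E := presEdge w)
    (T := presTriangle w) (ℓ := fun a b => π (presLabel w a b))
    (fun a => by rw [presLabel_self, map_one]) (fun a b => by rw [presLabel_swap, map_inv])
    (fun a => by rw [presLabel_base, map_one]) (fun t => by
      rw [← mul_inv_eq_one, ← map_mul, ← map_inv, ← map_mul]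
      rcases presLabel_triangle hw t with h | ⟨i, h⟩
      · rw [h, map_one]
      · rw [h, hπ])
  let f : (presComplex w).EdgeGroup (.inl none) (fun _ => .inl none) →*
      PresentedGroup (Set.range fun i => FreeGroup.mk (w i)) := EdgeGroup.lift hℓ
  have hf : ∀ a b, (presComplex w).Joined a b → f (presGen w a b) = π (presLabel w a b) :=
    fun a b h => (EdgeGroup.lift_gen hℓ a b).trans (if_pos h)
  let g : PresentedGroup (Set.range fun i => FreeGroup.mk (w i)) →*
      (presComplex w).EdgeGroup (.inl none) (fun _ => .inl none) :=
    PresentedGroup.toGroup (f := fun a =>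
      presGen w (.inl (some (a, false))) (.inl (some (a, true)))) <| by
        rintro _ ⟨i, rfl⟩
        exact presHom_relator (hw i)
  have hg : ∀ x, g (π x) = presHom w x := fun x => rfl
  refine ⟨MonoidHom.toMulEquiv f g (EdgeGroup.hom_ext fun a b => ?_)
    (PresentedGroup.ext fun a => ?_)⟩
  · change g (f (presGen w a b)) = presGen w a b
    by_cases h : (presComplex w).Joined a b
    · rw [hf a b h, hg, presHom_presLabel hw h]
    · have : presGen w a b = 1 :=
        (EdgeGroup.isTreeCocycle_gen (K := presComplex w)).off a b h
      rw [this, map_one, map_one]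
  · change f (g (π (FreeGroup.of a))) = π (FreeGroup.of a)
    rw [hg]
    change f (FreeGroup.lift _ (FreeGroup.of a)) = _
    rw [FreeGroup.lift_apply_of]
    refine (hf _ _ (joined_edge (E := presEdge w) a)).trans (congrArg π ?_)
    change wedgeLabel (some (a, false)) (some (a, true)) = _
    rw [wedgeLabel, if_pos (by simp)]
    rfl

end PresentationComplexGroup

/-! ### The lower bound and the theorem -/

/-- A group presented by nonempty words is the fundamental group of a complex whose number of
triangles is at most `6 * k - 1` for each relator of length `k`. -/
theorem exists_complex_of_presentation {α ι : Type} [Fintype α] [Fintype ι]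
    (w : ι → List (α × Bool)) (hw : ∀ i, w i ≠ []) :
    ∃ X : FiniteTwoComplex,
      X.HasFundamentalGroup (PresentedGroup (Set.range fun i => FreeGroup.mk (w i))) ∧
      X.numTriangles + Fintype.card ι ≤ 6 * ∑ i, (w i).length := by
  classical
  let X : FiniteTwoComplex := ⟨PresVertex w, presComplex w, card_le_three_ofTriangles⟩
  have htree : X.K.IsRootedTree (Sum.inl none) fun _ => Sum.inl none :=
    isRootedTree_ofTriangles (Sum.inl none) (presEdge w) (presTriangle w)
  refine ⟨X, (FiniteTwoComplex.hasFundamentalGroup_iff htree).mpr (nonempty_presComplex_equiv hw),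
    ?_⟩
  have h1 : X.numTriangles ≤ Fintype.card (PresTriangle w) := by
    rw [← Nat.card_eq_fintype_card, ← Set.ncard_univ]
    refine le_trans (Set.ncard_le_ncard (t := (fun t => ({(presTriangle w t).1,
      (presTriangle w t).2.1, (presTriangle w t).2.2} : Finset (PresVertex w))) '' Set.univ) ?_
      (Set.toFinite _)) (Set.ncard_image_le (Set.toFinite _))
    rintro s ⟨hs, h3⟩
    obtain ⟨t, rfl⟩ := exists_eq_of_mem_ofTriangles hs h3
    exact ⟨t, trivial, rfl⟩
  refine (Nat.add_le_add_right h1 _).trans ?_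
  rw [Fintype.card_sigma, Fintype.card_eq_sum_ones, ← Finset.sum_add_distrib, Finset.mul_sum]
  refine Finset.sum_le_sum fun i _ => ?_
  -- For a word of length k and q = `innerCount w i`, the claim is 3k + (q - 1) + 1 + (q - 2) + 1 ≤
  -- 6k, that is 2q ≤ 3k + 1. As k ≥ 1 gives q ≥ 2, the subtractions are not truncated.
  have := List.length_pos_iff.mpr (hw i)
  simp only [Fintype.card_sum, Fintype.card_fin, Fintype.card_unit]
  unfold innerCount
  omega

/-- The lower bound for the Matveev–Pervova complexity. -/
theorem simplicialComplexity_add_minRelators_le {G : Type*} [Group G] (h : cComplexity G ≠ ⊤) :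
    ∃ k m l : ℕ, simplicialComplexity G ≤ k ∧ minRelators G ≤ m ∧ cComplexity G = l ∧
      k + m ≤ 6 * l := by
  classical
  have hne : Nonempty (FinPresentation G) := by
    by_contra hn
    rw [not_nonempty_iff] at hn
    exact h (iInf_of_empty _)
  obtain ⟨P, hP⟩ := ENat.exists_eq_iInf (fun P : FinPresentation G => (P.length : ℕ∞))
  -- Trivial relators are dropped: they add nothing to the length, so the gain of one per relator
  -- fails for them. The remaining ones still number at least h(G).
  let w : {i : Fin P.m // P.rel i ≠ 1} → List (Fin P.n × Bool) := fun i => (P.rel i).toWord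
  have hw : ∀ i, w i ≠ [] := fun i hi => i.2 (FreeGroup.toWord_eq_nil_iff.mp hi)
  have hmk : ∀ i, FreeGroup.mk (w i) = P.rel i := fun i => FreeGroup.mk_toWord
  have hcl : Subgroup.normalClosure (Set.range fun i => FreeGroup.mk (w i)) =
      Subgroup.normalClosure (Set.range P.rel) := by
    apply le_antisymm
    · refine Subgroup.normalClosure_mono ?_
      rintro _ ⟨i, rfl⟩
      exact ⟨i, (hmk i).symm⟩
    · refine Subgroup.normalClosure_le_normal ?_
      rintro _ ⟨i, rfl⟩
      by_cases hi : P.rel i = 1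
      · rw [hi]
        exact one_mem _
      · exact Subgroup.subset_normalClosure ⟨⟨i, hi⟩, hmk _⟩
  let e : PresentedGroup (Set.range fun i => FreeGroup.mk (w i)) ≃* G :=
    (QuotientGroup.quotientMulEquivOfEq hcl).trans P.equiv
  obtain ⟨X, ⟨hc, x, ⟨f⟩⟩, hcard⟩ := exists_complex_of_presentation w hw
  obtain ⟨Q, hQ, -⟩ := exists_finPresentation _ e
  have hsum : ∑ i, (w i).length ≤ P.length := by
    have h := Finset.sum_subtype (F := inferInstance) (p := fun i => P.rel i ≠ 1)
      (Finset.univ.filter fun i => P.rel i ≠ 1) (by simp) (fun i => (P.rel i).norm)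
    exact h.symm.le.trans (Finset.sum_le_sum_of_subset (Finset.filter_subset _ _))
  refine ⟨X.numTriangles, Q.m, P.length, simplicialComplexity_le ⟨hc, x, ⟨f.trans e⟩⟩,
    minRelators_le Q, hP.symm, ?_⟩
  rw [hQ]
  omega

theorem ENat.toEReal_natCast (n : ℕ) : ((((n : ℕ∞) : ℝ≥0∞)) : EReal) = ((n : ℝ) : EReal) := by
  rw [ENat.toENNReal_coe, ← ENNReal.ofReal_natCast, EReal.coe_ennreal_ofReal,
    max_eq_left n.cast_nonneg]

/-- Both inequalities are between extended real numbers, so that the subtraction `κ(G) - 4` is not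
truncated at `0`. -/
theorem mainTheorem6 (G : Type*) [Group G] :
    (((simplicialComplexity G : ℝ≥0∞) : EReal) + ((minRelators G : ℝ≥0∞) : EReal)) / 6
        ≤ ((cComplexity G : ℝ≥0∞) : EReal) ∧
    (¬ IsFreeGroup G →
      ((cComplexity G : ℝ≥0∞) : EReal)
        ≤ 3 * (((simplicialComplexity G : ℝ≥0∞) : EReal) - 4)) := by
  have hmono : ∀ {a : ℕ∞} {n : ℕ}, a ≤ n → ((a : ℝ≥0∞) : EReal) ≤ ((n : ℝ) : EReal) :=
    fun {a n} h => by
      rw [← ENat.toEReal_natCast]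
      exact_mod_cast h
  have h6 : (6 : EReal) = ((6 : ℝ) : EReal) := rfl
  have h3 : (3 : EReal) = ((3 : ℝ) : EReal) := rfl
  have h4 : (4 : EReal) = ((4 : ℝ) : EReal) := rfl
  refine ⟨?_, fun hG => ?_⟩
  -- If c(G) is infinite there is nothing to prove. Otherwise a presentation exists, and all three
  -- quantities are finite.
  · by_cases hc : cComplexity G = ⊤
    · simp [hc]
    · obtain ⟨k, m, l, hk, hm, hl, hle⟩ := simplicialComplexity_add_minRelators_le hc
      rw [hl, ENat.toEReal_natCast, h6, EReal.div_le_iff_le_mul (by norm_num) (by simp)]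
      refine (add_le_add (hmono hk) (hmono hm)).trans ?_
      rw [← EReal.coe_add, ← EReal.coe_mul, EReal.coe_le_coe_iff]
      exact_mod_cast hle
  · by_cases hk : simplicialComplexity G = ⊤
    · have htop : (((simplicialComplexity G : ℝ≥0∞) : EReal) - 4) = ⊤ := by
        rw [hk, h4]
        simp
      rw [htop, h3, EReal.coe_mul_top_of_pos (by norm_num)]
      exact le_top
    · obtain ⟨k, l, hk, hl, hle⟩ := cComplexity_le_of_not_isFreeGroup hG hk
      refine (hmono hl).trans ?_
      rw [hk, ENat.toEReal_natCast, h3, h4, ← EReal.coe_sub, ← EReal.coe_mul,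
        EReal.coe_le_coe_iff]
      have : (l : ℝ) + 12 ≤ 3 * k := by exact_mod_cast hle
      linarith
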